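/- Let $G$ be a finite simple graph with vertex set $V$, $n=|V|\ge 1$, and let $\overline G$ be its complement. For a finite simple graph $H$ on $V$ with complement $\overline H$ and edge set $E(H)$, let $\vartheta^+(H)$ be the minimum of all real $t$ for which there is a positive semidefinite, entrywise nonnegative matrix $Z\in\mathbb R^{V\times V}$ such that $Z-J\succeq 0$ ($J$ the all-ones matrix), $Z_{uu}=t$ for all $u\in V$, and $Z_{uv}=0$ for all $\{u,v\}\in E(\overline H)$. For a real symmetric $m\times m$ matrix $M$ let $p_M=\sum_{i,j=1}^m M_{ij}X_i^2X_j^2$, a polynomial in $\mathbb R\langle X_1,\dots,X_m\rangle$ (non-commuting variables). Let $*$ be the linear involution of $\mathbb R\langle X_1,\dots,X_m\rangle$ that reverses words, and let $\mathrm{tr}\mathcal M$ be the set of all finite sums of polynomials of the forms $ff^*$, $g\,(1-\sum_{i=1}^m X_i^2)\,g^*$ and $fg-gf$ with $f,g\in\mathbb R\langle X_1,\dots,X_m\rangle$ (the tracial quadratic module of the ball). For $\varepsilon\ge 0$ let $\mathcal K_{\mathrm{nc},\varepsilon}$ be the set of real symmetric matrices $M$ with $p_M+\varepsilon\in\mathrm{tr}\mathcal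 M$. For $t\in[n]=\{1,\dots,n\}$ consider symmetric matrices of size $nt+1$ with rows and columns indexed by $0$ and by the pairs $ui$ with $u\in V$, $i\in[t]$. For $u\in V$ let $A^t_u$ have entries $1$ at $(0,0)$ and at all $(ui,uj)$, $-1$ at all $(0,ui)$ and $(ui,0)$, and $0$ elsewhere. Let $E^t_{a,b}$ be the elementary symmetric matrix with $\langle E^t_{a,b},X\rangle=X_{ab}$ for all symmetric $X$. Put $A=\bigoplus_{t=1}^n\sum_{u\in V}A^t_u$, $B=\bigoplus_{t=1}^n E^t_{0,0}$, $C=\bigoplus_{t=1}^n t\,E^t_{0,0}$, all of size $N=\sum_{t=1}^n(nt+1)$, and let $\widetilde E^t_{a,b}$ be the extension of $E^t_{a,b}$ by zeros to size $N$. Let $\Psi_\varepsilon(G)$ be the supremum, in $[-\infty,+\infty]$, of all $\lambda\in\mathbb R$ for which there are reals $\mu$, $y^t_{u,v,i}$ ($t\in[n]$, $i\in[t]$, $\{u,v\}\in E(G)$) and $z^t_{u,i,j}$ ($t\in[n]$, $u\in V$, $i\ne j\in[t]$) with $$C-\lambda B-\mu A-\sum y^t_{u,v,i}\,\widetilde E^t_{ui,vi}-\sum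 z^t_{u,i,j}\,\widetilde E^t_{ui,uj}\in\mathcal K_{\mathrm{nc},\varepsilon}.$$ Then for every real $\varepsilon\ge 0$ we have $\lceil\vartheta^+(\overline G)\rceil\le\Psi_\varepsilon(G)$, and equality holds if $\varepsilon=0$. -/

import Mathlib

open scoped Matrix

noncomputable section

namespace QuantumTheta

section TracialModule

variable {κ : Type*}

/-- The tracial quadratic module generated by a set `P` of polynomials in the free real algebra
on noncommuting variables indexed by `κ`: all finite sums of Hermitian squares `f f*`, of terms
`g p g*` with `p ∈ P`, and of commutators `f g - g f`. The involution `star` of `FreeAlgebra`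
reverses words and fixes the variables and the scalars. -/
def trQuadModule (P : Set (FreeAlgebra ℝ κ)) : AddSubmonoid (FreeAlgebra ℝ κ) :=
  AddSubmonoid.closure
    ({q | ∃ f, q = f * star f} ∪ {q | ∃ p ∈ P, ∃ g, q = g * p * star g} ∪
      {q | ∃ f g, q = f * g - g * f})

/-- The polynomial `1 - ∑ i, X_i ^ 2` describing the noncommutative ball. -/
def ballPoly (κ : Type*) [Fintype κ] : FreeAlgebra ℝ κ :=
  1 - ∑ i, FreeAlgebra.ι ℝ i ^ 2

/-- The noncommutative polynomial `p_M = ∑ i j, M i j X_i ^ 2 X_j ^ 2`. -/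
def matrixPoly [Fintype κ] (M : Matrix κ κ ℝ) : FreeAlgebra ℝ κ :=
  ∑ i, ∑ j, M i j • (FreeAlgebra.ι ℝ i ^ 2 * FreeAlgebra.ι ℝ j ^ 2)

/-- The set `K_{nc,ε}` of symmetric matrices `M` such that `p_M + ε` lies in the tracial quadratic
module of the ball. -/
def Knc (κ : Type*) [Fintype κ] (ε : ℝ) : Set (Matrix κ κ ℝ) :=
  {M | M.IsSymm ∧ matrixPoly M + algebraMap ℝ (FreeAlgebra ℝ κ) ε ∈ trQuadModule {ballPoly κ}}

end TracialModule

/-- The doubly nonnegative matrices: positive semidefinite with nonnegative entries. -/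
def DNN (κ : Type*) : Set (Matrix κ κ ℝ) :=
  {X | X.PosSemidef ∧ ∀ i j, 0 ≤ X i j}

variable {V : Type*}

/-- The values `t` of the feasible points of the program defining `ϑ⁺(H)`: there is a doubly
nonnegative `Z` with `Z - J` positive semidefinite, `Z u u = t` for every vertex `u`, and
`Z u v = 0` for every edge `{u, v}` of the complement of `H`. -/
def thetaPlusValues (H : SimpleGraph V) : Set ℝ :=
  {t | ∃ Z ∈ DNN V, (Z - Matrix.of fun _ _ => (1 : ℝ)).PosSemidef ∧
    (∀ u, Z u u = t) ∧ ∀ u v, Hᶜ.Adj u v → Z u v = 0}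

/-- Szegedy's number `ϑ⁺(H)`. For a graph with finitely many and at least one vertex, the set of
values contains the number of vertices and is bounded below by `1`. -/
def thetaPlus (H : SimpleGraph V) : ℝ :=
  sInf (thetaPlusValues H)

section Program

variable [Fintype V] [DecidableEq V]

/-- The range `[n] = {1, …, n}` of the parameter `t`, where `n` is the number of vertices. -/
abbrev Level (V : Type*) [Fintype V] : Type :=
  Finset.Icc 1 (Fintype.card V)

/-- Row and column indices of the `t`-th block, of size `n t + 1`: `none` is the index `0` and
`some (u, i)` is the index `ui`. -/
abbrev BlockIdx (V : Type*) [Fintype V] (t : Level V) : Type _ :=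
  Option (V × Fin (t : ℕ))

/-- Row and column indices of the direct sum of the blocks, `N = ∑ t ∈ [n], (n t + 1)` in all. -/
abbrev Idx (V : Type*) [Fintype V] : Type _ :=
  (t : Level V) × BlockIdx V t

/-- The elementary symmetric matrix `E_{a,b}`, with `⟨E_{a,b}, X⟩ = X a b` for symmetric `X`. -/
def elemSymm {κ : Type*} [DecidableEq κ] (a b : κ) : Matrix κ κ ℝ :=
  (1 / 2 : ℝ) • (Matrix.single a b 1 + Matrix.single b a 1)

/-- The matrix `A^t_u`: its entries are `1` at `(0, 0)` and at all `(ui, uj)`, `-1` at all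
`(0, ui)` and `(ui, 0)`, and `0` elsewhere. -/
def blockA (t : Level V) (u : V) : Matrix (BlockIdx V t) (BlockIdx V t) ℝ :=
  Matrix.of fun a b =>
    match a, b with
    | none, none => 1
    | none, some (v, _) => if v = u then -1 else 0
    | some (v, _), none => if v = u then -1 else 0
    | some (v, _), some (w, _) => if v = u ∧ w = u then 1 else 0

/-- `A = ⊕ t, ∑ u, A^t_u`. -/
def matA (V : Type*) [Fintype V] [DecidableEq V] : Matrix (Idx V) (Idx V) ℝ :=
  Matrix.blockDiagonal' fun t : Level V => ∑ u, blockA t u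

/-- `B = ⊕ t, E^t_{0,0}`. -/
def matB (V : Type*) [Fintype V] [DecidableEq V] : Matrix (Idx V) (Idx V) ℝ :=
  Matrix.blockDiagonal' fun t : Level V => elemSymm (none : BlockIdx V t) none

/-- `C = ⊕ t, t E^t_{0,0}`. -/
def matC (V : Type*) [Fintype V] [DecidableEq V] : Matrix (Idx V) (Idx V) ℝ :=
  Matrix.blockDiagonal' fun t : Level V =>
    ((t : ℕ) : ℝ) • elemSymm (none : BlockIdx V t) none

/-- The matrix `E^t_{ui,vj}` extended by zeros to the whole index set. -/
def extE (t : Level V) (u : V) (i : Fin (t : ℕ)) (v : V) (j : Fin (t : ℕ)) :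
    Matrix (Idx V) (Idx V) ℝ :=
  elemSymm (⟨t, some (u, i)⟩ : Idx V) ⟨t, some (v, j)⟩

/-- The matrix `C - λ B - μ A - ∑ y^t_{u,v,i} E^t_{ui,vi} - ∑ z^t_{u,i,j} E^t_{ui,uj}` of the
program. The first sum runs over the edges `{u, v}`, written here as the ordered adjacent pairs;
since `E^t_{ui,vi} = E^t_{vi,ui}` and the `y` are free, this gives the same family of matrices. -/
def dualMatrix (G : SimpleGraph V) [DecidableRel G.Adj] (lam mu : ℝ)
    (y : (t : Level V) → V → V → Fin (t : ℕ) → ℝ)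
    (z : (t : Level V) → V → Fin (t : ℕ) → Fin (t : ℕ) → ℝ) : Matrix (Idx V) (Idx V) ℝ :=
  matC V - lam • matB V - mu • matA V
    - ∑ t : Level V, ∑ i : Fin (t : ℕ), ∑ u : V, ∑ v : V,
        (if G.Adj u v then y t u v i • extE t u i v i else 0)
    - ∑ t : Level V, ∑ u : V, ∑ i : Fin (t : ℕ), ∑ j : Fin (t : ℕ),
        (if i ≠ j then z t u i j • extE t u i u j else 0)

/-- `Ψ_ε(G)`: the supremum, in the extended reals, of all `λ` for which some choice of the other
variables puts the matrix of the program in `K_{nc,ε}`. -/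
def Psi (ε : ℝ) (G : SimpleGraph V) [DecidableRel G.Adj] : EReal :=
  sSup {x | ∃ (lam mu : ℝ) (y : (t : Level V) → V → V → Fin (t : ℕ) → ℝ)
    (z : (t : Level V) → V → Fin (t : ℕ) → Fin (t : ℕ) → ℝ),
    dualMatrix G lam mu y z ∈ Knc (Idx V) ε ∧ x = (lam : EReal)}

end Program

end QuantumTheta

end

/-! Fix a level `t` and consider the doubly nonnegative matrices `X` of that block that vanish at
the positions of the `y` and `z` variables and satisfy `⟨∑ u, A_u, X⟩ = 0`. A nonzero such `X`
exists exactly when `t` is a feasible value for `ϑ⁺(Gᶜ)` (`primalBlock_mem_patternDNN` with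
`pairing_sum_blockA_primalBlock`, and conversely `level_mem_thetaPlusValues`). Feasible values form
the ray `[ϑ⁺, ∞)` and `1 ≤ ϑ⁺ ≤ n`, so the least feasible level is `⌈ϑ⁺⌉`.

Lower bound: put `λ = ⌈ϑ⁺⌉`. In a feasible block `(t - λ) E_{0,0}` is already entrywise nonnegative.
In an infeasible block `∑ u, A_u` is strictly positive on the nonzero matrices of the pattern cone,
so a large multiple of it compensates the negative objective (`exists_smul_add_mem_patternDual`).
The resulting matrix is a positive semidefinite plus a nonnegative one, and such matrices lie in
`K_{nc,ε}` for every `ε ≥ 0` (`DNNDual_subset_Knc`).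

Upper bound for `ε = 0`: matrices of `K_{nc,0}` pair nonnegatively with every doubly nonnegative `X`
(`sum_mul_nonneg_of_mem_Knc`), so weak duality against the block matrix at level `⌈ϑ⁺⌉` bounds `λ`.
For the pairing, take rotation-invariant functionals in degrees 0, 2 and 4, the last one built from
`X`. On the tracial module the triple of values is lexicographically nonnegative; on `p_M` it is
`(0, 0, ⟨M, X⟩)`. -/

noncomputable section

namespace QuantumTheta

/-! ### Traces on the free algebra, and `K_{nc,ε}` compared with the dual of the doubly nonnegative
cone. -/

section FreeWords

variable {κ : Type*}

/-- The linear functional on the free algebra with prescribed values on words. -/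
def wordFunctional (τ : FreeMonoid κ → ℝ) : FreeAlgebra ℝ κ →ₗ[ℝ] ℝ :=
  (FreeAlgebra.basisFreeMonoid ℝ κ).constr ℝ τ

/-- The monomial given by a word. -/
def wordMonomial : FreeMonoid κ →* FreeAlgebra ℝ κ :=
  FreeMonoid.lift (FreeAlgebra.ι ℝ)

theorem basisFreeMonoid_apply (w : FreeMonoid κ) :
    FreeAlgebra.basisFreeMonoid ℝ κ w = wordMonomial w := by
  simp [FreeAlgebra.basisFreeMonoid, wordMonomial, FreeAlgebra.equivMonoidAlgebraFreeMonoid,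
    MonoidAlgebra.lift_single]

@[simp]
theorem wordMonomial_of (i : κ) : wordMonomial (FreeMonoid.of i) = FreeAlgebra.ι ℝ i := by
  simp [wordMonomial]

@[simp]
theorem wordFunctional_wordMonomial (τ : FreeMonoid κ → ℝ) (w : FreeMonoid κ) :
    wordFunctional τ (wordMonomial w) = τ w := by
  rw [← basisFreeMonoid_apply, wordFunctional, Module.Basis.constr_basis]

/-- A functional whose values on words are invariant under rotation vanishes on commutators. -/
theorem wordFunctional_mul_comm {τ : FreeMonoid κ → ℝ} (hτ : ∀ v w, τ (v * w) = τ (w * v))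
    (f g : FreeAlgebra ℝ κ) : wordFunctional τ (f * g) = wordFunctional τ (g * f) := by
  have h : (LinearMap.mul ℝ (FreeAlgebra ℝ κ)).compr₂ (wordFunctional τ) =
      (LinearMap.mul ℝ (FreeAlgebra ℝ κ)).flip.compr₂ (wordFunctional τ) := by
    refine (FreeAlgebra.basisFreeMonoid ℝ κ).ext fun v =>
      (FreeAlgebra.basisFreeMonoid ℝ κ).ext fun w => ?_
    simp [basisFreeMonoid_apply, ← map_mul, hτ v w]
  exact LinearMap.congr_fun₂ h f g

/-- On a product `v h w` with words `v`, `w`, a functional supported on words of length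
`|v| + |w|` sees only the constant term of `h`. -/
theorem wordFunctional_mul_mul {τ : FreeMonoid κ → ℝ} (v w : FreeMonoid κ)
    (hτ : ∀ x, x.length ≠ (v * w).length → τ x = 0) (h : FreeAlgebra ℝ κ) :
    wordFunctional τ (wordMonomial v * h * wordMonomial w) =
      FreeAlgebra.algebraMapInv h * τ (v * w) := by
  have H : (wordFunctional τ) ∘ₗ LinearMap.mulRight ℝ (wordMonomial w) ∘ₗ
      LinearMap.mulLeft ℝ (wordMonomial v) =
      (τ (v * w)) • (FreeAlgebra.algebraMapInv (R := ℝ) (X := κ)).toLinearMap := by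
    refine (FreeAlgebra.basisFreeMonoid ℝ κ).ext fun x => ?_
    simp only [basisFreeMonoid_apply, LinearMap.comp_apply, LinearMap.mulRight_apply,
      LinearMap.mulLeft_apply, ← map_mul, wordFunctional_wordMonomial, LinearMap.smul_apply,
      AlgHom.toLinearMap_apply, smul_eq_mul]
    induction x using FreeMonoid.casesOn with
    | one => simp
    | of_mul a x =>
      rw [hτ _ (by simp [FreeMonoid.length_mul])]
      simp [FreeAlgebra.algebraMapInv]
  have := LinearMap.congr_fun H h
  simpa [mul_comm] using this

/-- A polynomial without constant term is a combination of the variables with polynomial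
coefficients. -/
theorem exists_eq_sum_ι_mul [Fintype κ] (f : FreeAlgebra ℝ κ)
    (hf : FreeAlgebra.algebraMapInv f = 0) :
    ∃ h : κ → FreeAlgebra ℝ κ, f = ∑ i, FreeAlgebra.ι ℝ i * h i := by
  classical
  -- The induction needs the version with a constant term, since sums and products leave the class
  -- of polynomials without one.
  suffices H : ∃ h : κ → FreeAlgebra ℝ κ,
      f = algebraMap ℝ _ (FreeAlgebra.algebraMapInv f) + ∑ i, FreeAlgebra.ι ℝ i * h i by
    simpa [hf] using H
  clear hf
  induction f using FreeAlgebra.induction with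
  | grade0 r => exact ⟨0, by simp [FreeAlgebra.algebraMap_leftInverse r]⟩
  | grade1 i => exact ⟨Pi.single i 1, by simp [FreeAlgebra.algebraMapInv, Pi.single_apply]⟩
  | add f g hf hg =>
    obtain ⟨a, ha⟩ := hf
    obtain ⟨b, hb⟩ := hg
    refine ⟨a + b, ?_⟩
    nth_rw 1 [ha, hb]
    simp only [map_add, Pi.add_apply, mul_add, Finset.sum_add_distrib]
    abel
  | mul f g hf hg =>
    obtain ⟨a, ha⟩ := hf
    obtain ⟨b, hb⟩ := hg
    refine ⟨fun i => a i * g + FreeAlgebra.algebraMapInv f • b i, ?_⟩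
    nth_rw 1 [ha, add_mul]
    nth_rw 1 [hb]
    simp only [map_mul, mul_add, Finset.sum_add_distrib, ← mul_assoc, Finset.sum_mul,
      Finset.mul_sum, ← Algebra.smul_def, Algebra.mul_smul_comm, Algebra.smul_mul_assoc]
    abel

theorem algebraMapInv_star (f : FreeAlgebra ℝ κ) :
    FreeAlgebra.algebraMapInv (star f) = FreeAlgebra.algebraMapInv f := by
  induction f using FreeAlgebra.induction with
  | grade0 r => simp
  | grade1 i => simp
  | add f g hf hg => simp [hf, hg]
  | mul f g hf hg => simp [hf, hg, mul_comm]

/-- The trace of words of length two that counts the squares `X_i ^ 2`. -/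
def squareTrace [DecidableEq κ] (w : FreeMonoid κ) : ℝ :=
  match w.toList with
  | [i, j] => if i = j then 1 else 0
  | _ => 0

/-- The trace on words of length four attached to a symmetric matrix `X`: its value is `X i j` on
the rotations of `X_i ^ 2 X_j ^ 2` and zero on all other words. -/
def quarticTrace [DecidableEq κ] (X : Matrix κ κ ℝ) (w : FreeMonoid κ) : ℝ :=
  match w.toList with
  | [i, j, k, l] => if i = j ∧ k = l then X i k else if j = k ∧ l = i then X i j else 0
  | _ => 0

theorem apply_mul_comm_of_rotate {τ : FreeMonoid κ → ℝ}
    (hτ : ∀ i w, τ (FreeMonoid.of i * w) = τ (w * FreeMonoid.of i)) (v w : FreeMonoid κ) :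
    τ (v * w) = τ (w * v) := by
  induction v using FreeMonoid.inductionOn' generalizing w with
  | one => simp
  | of_mul i v ih => rw [mul_assoc, hτ, mul_assoc, ih, mul_assoc]

theorem squareTrace_mul_comm [DecidableEq κ] (v w : FreeMonoid κ) :
    squareTrace (v * w) = squareTrace (w * v) := by
  refine apply_mul_comm_of_rotate (fun i w => ?_) v w
  simp only [squareTrace, FreeMonoid.toList_mul, FreeMonoid.toList_of]
  rcases FreeMonoid.toList w with _ | ⟨a, _ | ⟨b, l⟩⟩ <;> simp
  simp only [eq_comm]

theorem quarticTrace_mul_comm [DecidableEq κ] {X : Matrix κ κ ℝ} (hX : X.IsSymm)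
    (v w : FreeMonoid κ) : quarticTrace X (v * w) = quarticTrace X (w * v) := by
  refine apply_mul_comm_of_rotate (fun i w => ?_) v w
  simp only [quarticTrace, FreeMonoid.toList_mul, FreeMonoid.toList_of]
  rcases FreeMonoid.toList w with _ | ⟨a, _ | ⟨b, _ | ⟨c, _ | ⟨d, l⟩⟩⟩⟩ <;> simp
  have := hX.apply
  split_ifs <;> grind

theorem squareTrace_eq_zero [DecidableEq κ] {w : FreeMonoid κ} (hw : w.length ≠ 2) :
    squareTrace w = 0 := by
  have hw : w.toList.length ≠ 2 := hw
  simp only [squareTrace]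
  split <;> simp_all

theorem quarticTrace_eq_zero [DecidableEq κ] (X : Matrix κ κ ℝ) {w : FreeMonoid κ}
    (hw : w.length ≠ 4) : quarticTrace X w = 0 := by
  have hw : w.toList.length ≠ 4 := hw
  simp only [quarticTrace]
  split <;> simp_all

/-- Lexicographic nonnegativity of the traces in degrees zero, two and four. -/
def LexNonneg [DecidableEq κ] (X : Matrix κ κ ℝ) (q : FreeAlgebra ℝ κ) : Prop :=
  0 < FreeAlgebra.algebraMapInv q ∨ FreeAlgebra.algebraMapInv q = 0 ∧
    (0 < wordFunctional squareTrace q ∨ wordFunctional squareTrace q = 0 ∧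
      0 ≤ wordFunctional (quarticTrace X) q)

theorem LexNonneg.add [DecidableEq κ] {X : Matrix κ κ ℝ} {p q : FreeAlgebra ℝ κ}
    (hp : LexNonneg X p) (hq : LexNonneg X q) : LexNonneg X (p + q) := by
  simp only [LexNonneg, map_add] at *
  grind

/-- The involution moves the leading variables of `f` to the right end, so every word of `f p f*`
begins with some `X_i` and ends with some `X_j`. In degree two only the constant terms between them
survive, and the trace keeps `i = j`. -/
theorem wordFunctional_squareTrace_conj [Fintype κ] [DecidableEq κ] (h : κ → FreeAlgebra ℝ κ)
    (p : FreeAlgebra ℝ κ) :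
    wordFunctional squareTrace
      ((∑ i, FreeAlgebra.ι ℝ i * h i) * p * star (∑ i, FreeAlgebra.ι ℝ i * h i)) =
      FreeAlgebra.algebraMapInv p * ∑ i, FreeAlgebra.algebraMapInv (h i) ^ 2 := by
  have key : ∀ i j, wordFunctional squareTrace
      (FreeAlgebra.ι ℝ i * h i * p * (star (h j) * FreeAlgebra.ι ℝ j)) =
      FreeAlgebra.algebraMapInv p * (FreeAlgebra.algebraMapInv (h i) *
        FreeAlgebra.algebraMapInv (h j)) * if i = j then 1 else 0 := by
    intro i j
    have := wordFunctional_mul_mul (τ := squareTrace) (FreeMonoid.of i) (FreeMonoid.of j)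
      (fun x hx => squareTrace_eq_zero hx) (h i * p * star (h j))
    simp only [wordMonomial_of, mul_assoc] at this ⊢
    rw [this]
    simp [algebraMapInv_star, squareTrace]
    grind
  simp only [star_sum, star_mul, FreeAlgebra.star_ι, Finset.sum_mul, Finset.mul_sum, map_sum, key]
  simp [pow_two]

/-- The degree-four words are `X_i X_j X_l X_k`, with nonzero trace only if `i = j, k = l` or `i =
k, j = l`. The first case yields the quadratic form of `X`, the second a sum of squares weighted by
entries of `X`; the overlap is counted in the first. This is where both halves of double
nonnegativity enter. -/
theorem wordFunctional_quarticTrace_conj [Fintype κ] [DecidableEq κ] (X : Matrix κ κ ℝ)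
    (h : κ → κ → FreeAlgebra ℝ κ) (p : FreeAlgebra ℝ κ) :
    wordFunctional (quarticTrace X)
      ((∑ i, FreeAlgebra.ι ℝ i * ∑ j, FreeAlgebra.ι ℝ j * h i j) * p *
        star (∑ i, FreeAlgebra.ι ℝ i * ∑ j, FreeAlgebra.ι ℝ j * h i j)) =
      FreeAlgebra.algebraMapInv p *
        (∑ i, ∑ k, FreeAlgebra.algebraMapInv (h i i) * X i k * FreeAlgebra.algebraMapInv (h k k) +
         ∑ i, ∑ j, if i = j then 0 else FreeAlgebra.algebraMapInv (h i j) ^ 2 * X i j) := by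
  have key : ∀ i j k l, wordFunctional (quarticTrace X)
      (FreeAlgebra.ι ℝ i * (FreeAlgebra.ι ℝ j * h i j) * p *
        (star (h k l) * FreeAlgebra.ι ℝ l * FreeAlgebra.ι ℝ k)) =
      FreeAlgebra.algebraMapInv p * ((if i = j then if k = l then
          FreeAlgebra.algebraMapInv (h i j) * X i k * FreeAlgebra.algebraMapInv (h k l) else 0 else 0)
        + if i = k then if j = l then (if i = j then 0 else FreeAlgebra.algebraMapInv (h i j) *
        FreeAlgebra.algebraMapInv (h k l) * X i j) else 0 else 0) := by
    intro i j k l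
    have := wordFunctional_mul_mul (τ := quarticTrace X) (FreeMonoid.of i * FreeMonoid.of j)
      (FreeMonoid.of l * FreeMonoid.of k)
      (fun x hx => quarticTrace_eq_zero X hx) (h i j * p * star (h k l))
    simp only [wordMonomial_of, map_mul, mul_assoc] at this ⊢
    rw [this]
    simp [algebraMapInv_star, quarticTrace]
    grind
  simp only [star_sum, star_mul, FreeAlgebra.star_ι, Finset.sum_mul, Finset.mul_sum, map_sum, key]
  simp only [← Finset.mul_sum, Finset.sum_add_distrib]
  congr 2
  · simp
    exact Finset.sum_comm
  · simp [pow_two]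

/-- As `p` has constant term 1, the lowest-degree part of `f p f*` is that of `f f*`. A nonzero
constant term of `f` decides in degree 0, otherwise a nonzero linear part in degree 2; if both
vanish, degree 4 is nonnegative. The choices `p = 1` and `p = 1 - ∑ X_i²` cover both kinds of
generators. -/
theorem LexNonneg.conj [Fintype κ] [DecidableEq κ] {X : Matrix κ κ ℝ} (hX : X ∈ DNN κ)
    {p : FreeAlgebra ℝ κ} (hp : FreeAlgebra.algebraMapInv p = 1) (f : FreeAlgebra ℝ κ) :
    LexNonneg X (f * p * star f) := by
  have h0 : FreeAlgebra.algebraMapInv (f * p * star f) = FreeAlgebra.algebraMapInv f ^ 2 := by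
    simp [hp, algebraMapInv_star, pow_two]
  by_cases hf : FreeAlgebra.algebraMapInv f = 0
  swap
  · left
    rw [h0]
    positivity
  refine Or.inr ⟨by simp [h0, hf], ?_⟩
  obtain ⟨h, rfl⟩ := exists_eq_sum_ι_mul f hf
  rw [wordFunctional_squareTrace_conj, hp, one_mul]
  by_cases hh : ∀ i, FreeAlgebra.algebraMapInv (h i) = 0
  swap
  · left
    obtain ⟨i, hi⟩ := not_forall.1 hh
    exact Finset.sum_pos' (fun j _ => sq_nonneg _) ⟨i, Finset.mem_univ i, by positivity⟩
  refine Or.inr ⟨by simp [hh], ?_⟩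
  choose g hg using fun i => exists_eq_sum_ι_mul (h i) (hh i)
  obtain rfl : h = fun i => ∑ j, FreeAlgebra.ι ℝ j * g i j := funext hg
  rw [wordFunctional_quarticTrace_conj, hp, one_mul]
  refine add_nonneg ?_ (Finset.sum_nonneg fun i _ => Finset.sum_nonneg fun j _ => ?_)
  · have := hX.1.dotProduct_mulVec_nonneg fun i => FreeAlgebra.algebraMapInv (g i i)
    simpa [dotProduct, Matrix.mulVec, Finset.mul_sum, mul_assoc] using this
  · have := hX.2 i j
    split_ifs <;> positivity

theorem LexNonneg.of_mem_trQuadModule [Fintype κ] [DecidableEq κ] {X : Matrix κ κ ℝ}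
    (hX : X ∈ DNN κ) {q : FreeAlgebra ℝ κ} (hq : q ∈ trQuadModule {ballPoly κ}) :
    LexNonneg X q := by
  have hsymm : X.IsSymm := by simpa using hX.1.isHermitian
  refine AddSubmonoid.closure_induction (fun q hq => ?_) ?_ (fun p q _ _ hp hq => hp.add hq) hq
  · rcases hq with (⟨f, rfl⟩ | ⟨p, rfl, f, rfl⟩) | ⟨f, g, rfl⟩
    · simpa using LexNonneg.conj hX (map_one _) f
    · exact LexNonneg.conj hX (by simp [ballPoly, FreeAlgebra.algebraMapInv]) f
    · simp [LexNonneg, wordFunctional_mul_comm squareTrace_mul_comm f g,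
        wordFunctional_mul_comm (quarticTrace_mul_comm hsymm) f g, mul_comm]
  · simp [LexNonneg]

/-- Matrices in `K_{nc,0}` pair nonnegatively with doubly nonnegative matrices. -/
theorem sum_mul_nonneg_of_mem_Knc [Fintype κ] [DecidableEq κ] {M X : Matrix κ κ ℝ}
    (hM : M ∈ Knc κ 0) (hX : X ∈ DNN κ) : 0 ≤ ∑ i, ∑ j, M i j * X i j := by
  have h := LexNonneg.of_mem_trQuadModule hX hM.2
  have hw : ∀ i j : κ, FreeAlgebra.ι ℝ i ^ 2 * FreeAlgebra.ι ℝ j ^ 2 =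
      wordMonomial (FreeMonoid.of i * FreeMonoid.of i * (FreeMonoid.of j * FreeMonoid.of j)) := by
    simp [pow_two]
  have h0 : FreeAlgebra.algebraMapInv (matrixPoly M) = 0 := by
    simp [matrixPoly, FreeAlgebra.algebraMapInv]
  have h2 : wordFunctional squareTrace (matrixPoly M) = 0 := by
    simp only [matrixPoly, map_sum, map_smul, hw, wordFunctional_wordMonomial]
    simp [squareTrace]
  have h4 : wordFunctional (quarticTrace X) (matrixPoly M) = ∑ i, ∑ j, M i j * X i j := by
    simp only [matrixPoly, map_sum, map_smul, hw, wordFunctional_wordMonomial]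
    simp [quarticTrace]
  simpa [LexNonneg, h0, h2, h4] using h

/-- The dual cone of the doubly nonnegative matrices, as sums of positive semidefinite and
symmetric nonnegative matrices. -/
def DNNDual (κ : Type*) : Set (Matrix κ κ ℝ) :=
  {M | ∃ P N : Matrix κ κ ℝ, P.PosSemidef ∧ N.IsSymm ∧ (∀ i j, 0 ≤ N i j) ∧ M = P + N}

open scoped MatrixOrder Matrix.Norms.L2Operator in
theorem exists_eq_conjTranspose_mul_self [Fintype κ] {M : Matrix κ κ ℝ} (hM : M.PosSemidef) :
    ∃ B : Matrix κ κ ℝ, M = Bᴴ * B := by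
  classical
  exact CStarAlgebra.nonneg_iff_eq_star_mul_self.mp hM.nonneg

theorem star_smul_freeAlgebra (r : ℝ) (f : FreeAlgebra ℝ κ) : star (r • f) = r • star f := by
  rw [Algebra.smul_def, star_mul, FreeAlgebra.star_algebraMap, ← Algebra.commutes,
    ← Algebra.smul_def]

theorem matrixPoly_add [Fintype κ] (M N : Matrix κ κ ℝ) :
    matrixPoly (M + N) = matrixPoly M + matrixPoly N := by
  simp [matrixPoly, add_smul, Finset.sum_add_distrib]

theorem matrixPoly_mem_of_posSemidef [Fintype κ] {M : Matrix κ κ ℝ} (hM : M.PosSemidef)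
    (P : Set (FreeAlgebra ℝ κ)) : matrixPoly M ∈ trQuadModule P := by
  classical
  obtain ⟨B, rfl⟩ := exists_eq_conjTranspose_mul_self hM
  have : matrixPoly (Bᴴ * B) = ∑ k, (∑ i, B k i • FreeAlgebra.ι ℝ i ^ 2) *
      star (∑ i, B k i • FreeAlgebra.ι ℝ i ^ 2) := by
    simp only [matrixPoly, Matrix.mul_apply, Matrix.conjTranspose_apply, star_trivial,
      Finset.sum_smul, star_sum, star_smul_freeAlgebra, star_pow, FreeAlgebra.star_ι, Finset.sum_mul_sum,
      smul_mul_smul_comm]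
    rw [Finset.sum_comm_cycle]
  rw [this]
  exact sum_mem fun k _ => AddSubmonoid.subset_closure (Or.inl (Or.inl ⟨_, rfl⟩))

/-- Up to a commutator, `x²y²` is the Hermitian square `(xy)(xy)* = xyyx`. -/
theorem matrixPoly_mem_of_nonneg [Fintype κ] {M : Matrix κ κ ℝ} (hM : ∀ i j, 0 ≤ M i j)
    (P : Set (FreeAlgebra ℝ κ)) : matrixPoly M ∈ trQuadModule P := by
  refine sum_mem fun i _ => sum_mem fun j _ => ?_
  set x := FreeAlgebra.ι ℝ i
  set y := FreeAlgebra.ι ℝ j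
  have h : M i j • (x ^ 2 * y ^ 2) = (√(M i j) • (x * y)) * star (√(M i j) • (x * y)) +
      ((M i j • x) * (x * y * y) - (x * y * y) * (M i j • x)) := by
    rw [star_smul_freeAlgebra, smul_mul_smul_comm, Real.mul_self_sqrt (hM i j)]
    simp [x, y, pow_two, mul_assoc]
  rw [h]
  exact add_mem (AddSubmonoid.subset_closure (Or.inl (Or.inl ⟨_, rfl⟩)))
    (AddSubmonoid.subset_closure (Or.inr ⟨_, _, rfl⟩))

theorem DNNDual_subset_Knc [Fintype κ] {ε : ℝ} (hε : 0 ≤ ε) : DNNDual κ ⊆ Knc κ ε := by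
  rintro _ ⟨P, N, hP, hNs, hN, rfl⟩
  refine ⟨Matrix.IsSymm.add (by simpa using hP.isHermitian) hNs, ?_⟩
  rw [matrixPoly_add]
  refine add_mem (add_mem (matrixPoly_mem_of_posSemidef hP _) (matrixPoly_mem_of_nonneg hN _))
    (AddSubmonoid.subset_closure (Or.inl (Or.inl ⟨algebraMap ℝ _ √ε, ?_⟩)))
  rw [FreeAlgebra.star_algebraMap, ← map_mul, Real.mul_self_sqrt hε]

end FreeWords

/-! ### Conic duality for doubly nonnegative matrices with prescribed zeros. -/

section ConicAlternative

variable {κ : Type*}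

theorem DNN.smul_mem {X : Matrix κ κ ℝ} (hX : X ∈ DNN κ) {c : ℝ} (hc : 0 ≤ c) :
    c • X ∈ DNN κ :=
  ⟨hX.1.smul hc, fun i j => mul_nonneg hc (hX.2 i j)⟩

theorem DNNDual.add {M N : Matrix κ κ ℝ} (hM : M ∈ DNNDual κ) (hN : N ∈ DNNDual κ) :
    M + N ∈ DNNDual κ := by
  obtain ⟨P, Q, hP, hQ, hQ0, rfl⟩ := hM
  obtain ⟨P', Q', hP', hQ', hQ0', rfl⟩ := hN
  exact ⟨P + P', Q + Q', hP.add hP', hQ.add hQ', fun i j => add_nonneg (hQ0 i j) (hQ0' i j),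
    by abel⟩

theorem DNNDual.smul {M : Matrix κ κ ℝ} (hM : M ∈ DNNDual κ) {c : ℝ} (hc : 0 ≤ c) :
    c • M ∈ DNNDual κ := by
  obtain ⟨P, Q, hP, hQ, hQ0, rfl⟩ := hM
  exact ⟨c • P, c • Q, hP.smul hc, hQ.smul c, fun i j => mul_nonneg hc (hQ0 i j), smul_add _ _ _⟩

theorem DNNDual.of_posSemidef {P : Matrix κ κ ℝ} (hP : P.PosSemidef) : P ∈ DNNDual κ :=
  ⟨P, 0, hP, by simp, by simp, by simp⟩

theorem DNNDual.of_nonneg {N : Matrix κ κ ℝ} (hN : N.IsSymm) (h : ∀ i j, 0 ≤ N i j) :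
    N ∈ DNNDual κ :=
  ⟨0, N, .zero, hN, h, by simp⟩

/-- The sum of the dual cone of the doubly nonnegative matrices and of the symmetric matrices
supported on `S`. -/
def patternDual (S : κ → κ → Prop) : Set (Matrix κ κ ℝ) :=
  {M | ∃ W : Matrix κ κ ℝ, W.IsSymm ∧ (∀ i j, ¬ S i j → W i j = 0) ∧ M - W ∈ DNNDual κ}

theorem DNNDual_subset_patternDual (S : κ → κ → Prop) : DNNDual κ ⊆ patternDual S :=
  fun M hM => ⟨0, by simp, by simp, by simpa using hM⟩

theorem patternDual.add {S : κ → κ → Prop} {M N : Matrix κ κ ℝ} (hM : M ∈ patternDual S)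
    (hN : N ∈ patternDual S) : M + N ∈ patternDual S := by
  obtain ⟨W, hW, hWS, h⟩ := hM
  obtain ⟨W', hW', hWS', h'⟩ := hN
  refine ⟨W + W', hW.add hW', fun i j hij => by simp [hWS i j hij, hWS' i j hij], ?_⟩
  simpa [add_sub_add_comm] using DNNDual.add h h'

theorem patternDual.smul {S : κ → κ → Prop} {M : Matrix κ κ ℝ} (hM : M ∈ patternDual S)
    {c : ℝ} (hc : 0 ≤ c) : c • M ∈ patternDual S := by
  obtain ⟨W, hW, hWS, h⟩ := hM
  refine ⟨c • W, hW.smul c, fun i j hij => by simp [hWS i j hij], ?_⟩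
  simpa [smul_sub] using DNNDual.smul h hc

variable [Fintype κ]

theorem posSemidef_iff_sum {M : Matrix κ κ ℝ} :
    M.PosSemidef ↔ M.IsSymm ∧ ∀ x : κ → ℝ, 0 ≤ ∑ i, ∑ j, x i * M i j * x j := by
  rw [Matrix.posSemidef_iff_dotProduct_mulVec, Matrix.IsHermitian,
    Matrix.conjTranspose_eq_transpose_of_trivial]
  simp [dotProduct, Matrix.mulVec, Finset.mul_sum, mul_assoc, Matrix.IsSymm]

/-- The trace inner product of two real matrices. -/
def pairing (M X : Matrix κ κ ℝ) : ℝ := ∑ i, ∑ j, M i j * X i j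

theorem pairing_add_left (M N X : Matrix κ κ ℝ) :
    pairing (M + N) X = pairing M X + pairing N X := by
  simp [pairing, add_mul, Finset.sum_add_distrib]

theorem pairing_sub_left (M N X : Matrix κ κ ℝ) :
    pairing (M - N) X = pairing M X - pairing N X := by
  simp [pairing, sub_mul, Finset.sum_sub_distrib]

theorem pairing_smul_left (c : ℝ) (M X : Matrix κ κ ℝ) :
    pairing (c • M) X = c * pairing M X := by
  simp [pairing, Finset.mul_sum, mul_assoc]

theorem pairing_smul_right (c : ℝ) (M X : Matrix κ κ ℝ) :
    pairing M (c • X) = c * pairing M X := by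
  simp [pairing, Finset.mul_sum, mul_left_comm]

theorem pairing_sum_left {ι : Type*} (s : Finset ι) (M : ι → Matrix κ κ ℝ) (X : Matrix κ κ ℝ) :
    pairing (∑ i ∈ s, M i) X = ∑ i ∈ s, pairing (M i) X := by
  simp only [pairing, Matrix.sum_apply, Finset.sum_mul]
  rw [Finset.sum_comm_cycle]

theorem pairing_one_left [DecidableEq κ] (X : Matrix κ κ ℝ) : pairing 1 X = X.trace := by
  simp [pairing, Matrix.one_apply, Matrix.trace]

theorem pairing_vecMulVec (x : κ → ℝ) (X : Matrix κ κ ℝ) :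
    pairing (Matrix.vecMulVec x x) X = ∑ i, ∑ j, x i * X i j * x j := by
  simp only [pairing, Matrix.vecMulVec_apply]
  exact Finset.sum_congr rfl fun i _ => Finset.sum_congr rfl fun j _ => by ring

theorem pairing_elemSymm [DecidableEq κ] (a b : κ) {X : Matrix κ κ ℝ} (hX : X.IsSymm) :
    pairing (elemSymm a b) X = X a b := by
  have h : ∀ a b : κ, pairing (Matrix.single a b (1 : ℝ)) X = X a b := by
    intro a b
    simp [pairing, Matrix.single_apply, ite_and]
  rw [elemSymm, pairing_smul_left, pairing_add_left, h, h, hX.apply a b]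
  ring

theorem two_mul_le_of_posSemidef {X : Matrix κ κ ℝ} (hX : X.PosSemidef) (i j : κ) :
    2 * X i j ≤ X i i + X j j := by
  classical
  have h := (posSemidef_iff_sum.1 hX).2 (Pi.single i 1 - Pi.single j 1)
  have hs : X j i = X i j := (posSemidef_iff_sum.1 hX).1.apply i j
  simp [sub_mul, mul_sub, Finset.sum_sub_distrib, Pi.single_apply] at h
  linarith

theorem isClosed_posSemidef : IsClosed {X : Matrix κ κ ℝ | X.PosSemidef} := by
  simp only [posSemidef_iff_sum, Set.ofPred_and, Set.ofPred_forall]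
  refine IsClosed.inter ?_ (isClosed_iInter fun x => ?_)
  · exact isClosed_eq (by fun_prop) (by fun_prop)
  · exact isClosed_le (by fun_prop) (by fun_prop)

theorem isClosed_DNN : IsClosed (DNN κ) := by
  simp only [DNN, Set.ofPred_and, Set.ofPred_forall]
  refine isClosed_posSemidef.inter (isClosed_iInter fun i => isClosed_iInter fun j => ?_)
  exact isClosed_le (by fun_prop) (by fun_prop)

theorem isCompact_DNN_of_diag_le (c : ℝ) : IsCompact {X | X ∈ DNN κ ∧ ∀ i, X i i ≤ c} := by
  have hK : IsCompact (Set.univ.pi fun _ : κ => Set.univ.pi fun _ : κ => Set.Icc (0 : ℝ) c) :=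
    isCompact_univ_pi fun _ => isCompact_univ_pi fun _ => isCompact_Icc
  refine IsCompact.of_isClosed_subset (X := Matrix κ κ ℝ) hK ?_ ?_
  · simp only [Set.ofPred_and, Set.ofPred_forall]
    refine isClosed_DNN.inter (isClosed_iInter fun i => ?_)
    exact isClosed_le (by fun_prop) (by fun_prop)
  · rintro X ⟨hX, hc⟩ i - j -
    have := two_mul_le_of_posSemidef hX.1 i j
    exact ⟨hX.2 i j, by linarith [hc i, hc j]⟩

/-- The doubly nonnegative matrices that vanish at the positions in `S`. -/
def patternDNN (S : κ → κ → Prop) : Set (Matrix κ κ ℝ) :=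
  {X | X ∈ DNN κ ∧ ∀ i j, S i j → X i j = 0}

/-- The trace-one slice of the cone is compact, so `pairing A` attains a positive minimum on it;
homogeneity extends the bound to the whole cone. -/
theorem exists_pos_mul_trace_le_pairing (S : κ → κ → Prop) (A : Matrix κ κ ℝ)
    (hA : ∀ X ∈ patternDNN S, X ≠ 0 → 0 < pairing A X) :
    ∃ η > 0, ∀ X ∈ patternDNN S, η * X.trace ≤ pairing A X := by
  have hcont : Continuous fun X : Matrix κ κ ℝ => pairing A X := by
    unfold pairing
    fun_prop
  have hK : IsCompact {X | X ∈ patternDNN S ∧ X.trace = 1} := by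
    refine (isCompact_DNN_of_diag_le (κ := κ) 1).of_isClosed_subset ?_ ?_
    · simp only [patternDNN, Set.ofPred_and, Set.ofPred_forall]
      refine (isClosed_DNN.inter (isClosed_iInter fun i => isClosed_iInter fun j =>
        isClosed_iInter fun _ => ?_)).inter ?_
      · exact isClosed_eq (by fun_prop) (by fun_prop)
      · exact isClosed_eq (by unfold Matrix.trace; fun_prop) (by fun_prop)
    · rintro X ⟨hX, htr⟩
      refine ⟨hX.1, fun i => htr ▸ ?_⟩
      exact Finset.single_le_sum (f := fun i => X i i) (fun j _ => hX.1.2 j j) (Finset.mem_univ i)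
  have hscale : ∀ η : ℝ, (∀ X ∈ patternDNN S, X.trace = 1 → η ≤ pairing A X) →
      ∀ X ∈ patternDNN S, η * X.trace ≤ pairing A X := by
    intro η h X hX
    rcases hX.1.1.trace_nonneg.eq_or_lt with h0 | h0
    · have : X = 0 := hX.1.1.trace_eq_zero_iff.1 h0.symm
      simp [this, pairing]
    · have := h (X.trace⁻¹ • X) ⟨DNN.smul_mem hX.1 (by positivity),
        fun i j hij => by simp [hX.2 i j hij]⟩ (by simp [h0.ne'])
      rw [pairing_smul_right, inv_mul_eq_div, le_div_iff₀ h0] at this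
      exact this
  by_cases hne : {X | X ∈ patternDNN S ∧ X.trace = 1}.Nonempty
  · obtain ⟨X, hX, hmin⟩ := hK.exists_isMinOn hne hcont.continuousOn
    refine ⟨pairing A X, hA X hX.1 ?_, hscale _ fun Y hY h1 => hmin ⟨hY, h1⟩⟩
    rintro rfl
    simpa using hX.2
  · refine ⟨1, one_pos, hscale 1 fun Y hY h1 => ?_⟩
    exact (hne ⟨Y, hY, h1⟩).elim

theorem exists_eq_pairing [DecidableEq κ] (f : Matrix κ κ ℝ →ₗ[ℝ] ℝ) :
    ∃ X : Matrix κ κ ℝ, X.IsSymm ∧ ∀ M : Matrix κ κ ℝ, M.IsSymm → f M = pairing M X := by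
  refine ⟨Matrix.of fun i j => (f (Matrix.single i j 1) + f (Matrix.single j i 1)) / 2, ?_, ?_⟩
  · ext i j
    simp [add_comm]
  · intro M hM
    have h : f M = ∑ i, ∑ j, M i j * f (Matrix.single i j 1) := by
      conv_lhs => rw [Matrix.matrix_eq_sum_single M]
      simp only [map_sum]
      refine Finset.sum_congr rfl fun i _ => Finset.sum_congr rfl fun j _ => ?_
      rw [← smul_eq_mul, ← map_smul, Matrix.smul_single, smul_eq_mul, mul_one]
    have h' : f M = ∑ i, ∑ j, M i j * f (Matrix.single j i 1) := by
      rw [h, Finset.sum_comm]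
      exact Finset.sum_congr rfl fun i _ => Finset.sum_congr rfl fun j _ => by rw [hM.apply]
    have : pairing M (Matrix.of fun i j =>
        (f (Matrix.single i j 1) + f (Matrix.single j i 1)) / 2) = (f M + f M) / 2 := by
      nth_rw 1 [h]
      rw [h', ← Finset.sum_add_distrib, Finset.sum_div]
      refine Finset.sum_congr rfl fun i _ => ?_
      rw [← Finset.sum_add_distrib, Finset.sum_div]
      refine Finset.sum_congr rfl fun j _ => ?_
      simp
      ring
    rw [this]
    ring

/-- A symmetric matrix that pairs nonnegatively with the doubly nonnegative matrices vanishing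
on `S` lies in the closure of the dual cone. -/
theorem mem_closure_patternDual [DecidableEq κ] {S : κ → κ → Prop} (hS : ∀ i j, S i j → S j i)
    {M : Matrix κ κ ℝ} (hM : M.IsSymm) (h : ∀ X ∈ patternDNN S, 0 ≤ pairing M X) :
    M ∈ closure (patternDual S) := by
  have : LocallyConvexSpace ℝ (Matrix κ κ ℝ) :=
    inferInstanceAs (LocallyConvexSpace ℝ (κ → κ → ℝ))
  by_contra hcl
  have hconv : Convex ℝ (patternDual S) := fun M hM N hN a b ha hb _ =>
    patternDual.add (patternDual.smul hM ha) (patternDual.smul hN hb)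
  obtain ⟨f, u, hfM, hfu⟩ := geometric_hahn_banach_point_closed hconv.closure isClosed_closure hcl
  have h0 : (0 : Matrix κ κ ℝ) ∈ patternDual S :=
    DNNDual_subset_patternDual S (DNNDual.of_posSemidef .zero)
  have hu : u < 0 := by simpa using hfu 0 (subset_closure h0)
  have hnn : ∀ N ∈ patternDual S, 0 ≤ f N := by
    intro N hN
    by_contra! hlt
    -- The scaling factor brings the value of `f` to exactly `u`, against the strict separation.
    have := hfu _ (subset_closure (patternDual.smul hN (c := u / f N) (div_nonneg_of_nonpos hu.le hlt.le)))
    rw [map_smul, smul_eq_mul, div_mul_cancel₀ _ hlt.ne] at this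
    exact this.false
  obtain ⟨X, hXs, hX⟩ := exists_eq_pairing f.toLinearMap
  have hX : ∀ M : Matrix κ κ ℝ, M.IsSymm → f M = pairing M X := hX
  have helem : ∀ i j : κ, (elemSymm i j).IsSymm := fun i j => by
    simp [elemSymm, Matrix.IsSymm, Matrix.transpose_add, add_comm]
  refine (hfM.trans hu).not_ge ?_
  rw [hX M hM]
  refine h X ⟨⟨posSemidef_iff_sum.2 ⟨hXs, fun x => ?_⟩, fun i j => ?_⟩, fun i j hij => ?_⟩
  · rw [← pairing_vecMulVec, ← hX _ (by simp [Matrix.IsSymm, Matrix.transpose_vecMulVec])]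
    refine hnn _ (DNNDual_subset_patternDual S (DNNDual.of_posSemidef ?_))
    simpa using Matrix.posSemidef_vecMulVec_self_star x
  · rw [← pairing_elemSymm i j hXs, ← hX _ (helem i j)]
    refine hnn _ (DNNDual_subset_patternDual S (DNNDual.of_nonneg (helem i j) fun a b => ?_))
    simp only [elemSymm, Matrix.smul_apply, Matrix.add_apply, Matrix.single_apply, smul_eq_mul]
    positivity
  -- On positions of `S` both signs are allowed in the dual cone, which forces the entry of `X` to
  -- be zero.
  · have hW : ∀ c : ℝ, c • elemSymm i j ∈ patternDual S := fun c => by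
      refine ⟨c • elemSymm i j, (helem i j).smul c, fun a b hab => ?_, ?_⟩
      · have h1 : ¬ (i = a ∧ j = b) := by
          rintro ⟨rfl, rfl⟩
          exact hab hij
        have h2 : ¬ (j = a ∧ i = b) := by
          rintro ⟨rfl, rfl⟩
          exact hab (hS _ _ hij)
        simp [elemSymm, h1, h2]
      · simpa using DNNDual.of_posSemidef .zero
    have h1 := hnn _ (hW 1)
    have h2 := hnn _ (hW (-1))
    rw [map_smul, hX _ (helem i j), pairing_elemSymm i j hXs, smul_eq_mul] at h1 h2
    linarith

/-- By `|x_i x_j| ≤ (x_i² + x_j²) / 2`, the form of `D` is at least `-∑ x_i²`. This lets the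
identity absorb the error of an approximation, so no closedness of `patternDual` is needed. -/
theorem posSemidef_one_add_of_abs_le [DecidableEq κ] {D : Matrix κ κ ℝ} (hD : D.IsSymm)
    (h : ∀ i j, |D i j| ≤ (Fintype.card κ : ℝ)⁻¹) : (1 + D).PosSemidef := by
  refine posSemidef_iff_sum.2 ⟨Matrix.isSymm_one.add hD, fun x => ?_⟩
  have h1 : ∀ i j, -((Fintype.card κ : ℝ)⁻¹ * ((x i ^ 2 + x j ^ 2) / 2)) ≤ x i * D i j * x j := by
    intro i j
    have h2 : |x i * D i j * x j| ≤ (Fintype.card κ : ℝ)⁻¹ * ((x i ^ 2 + x j ^ 2) / 2) := by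
      rw [mul_comm (x i), mul_assoc, abs_mul]
      refine mul_le_mul (h i j) ?_ (abs_nonneg _) (by positivity)
      rw [abs_le]
      constructor <;> nlinarith [sq_nonneg (x i + x j), sq_nonneg (x i - x j)]
    exact (abs_le.1 h2).1
  have h3 := Finset.sum_le_sum fun i (_ : i ∈ Finset.univ) =>
    Finset.sum_le_sum fun j (_ : j ∈ Finset.univ) => h1 i j
  have h4 : ∑ i, ∑ j, x i * (1 + D) i j * x j =
      ∑ i, x i ^ 2 + ∑ i, ∑ j, x i * D i j * x j := by
    simp [mul_add, add_mul, Finset.sum_add_distrib, Matrix.one_apply, pow_two]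
  have h5 : ∑ i : κ, ∑ j : κ, -((Fintype.card κ : ℝ)⁻¹ * ((x i ^ 2 + x j ^ 2) / 2)) =
      - ∑ i, x i ^ 2 := by
    rcases isEmpty_or_nonempty κ with _ | _
    · simp
    have hc : (Fintype.card κ : ℝ) ≠ 0 := by simp
    simp only [Finset.sum_neg_distrib, ← Finset.mul_sum, ← Finset.sum_div, Finset.sum_add_distrib,
      Finset.sum_const, Finset.card_univ, nsmul_eq_mul]
    field_simp
    ring
  rw [h4]
  linarith

/-- Conic alternative: if `A` pairs positively with the nonzero doubly nonnegative matrices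
vanishing on `S`, then large multiples of `A` dominate any symmetric matrix. -/
theorem exists_smul_add_mem_patternDual [DecidableEq κ] {S : κ → κ → Prop}
    (hS : ∀ i j, S i j → S j i) {A C : Matrix κ κ ℝ} (hA : A.IsSymm) (hC : C.IsSymm)
    (h : ∀ X ∈ patternDNN S, X ≠ 0 → 0 < pairing A X) :
    ∃ m : ℝ, m • A + C ∈ patternDual S := by
  obtain ⟨η, hη, hηA⟩ := exists_pos_mul_trace_le_pairing S A h
  obtain ⟨c, hc0, hc⟩ : ∃ c : ℝ, 0 ≤ c ∧ ∀ X ∈ DNN κ, -(c * X.trace) ≤ pairing C X := by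
    refine ⟨∑ i, ∑ j, |C i j|, by positivity, fun X hX => ?_⟩
    rw [Finset.sum_mul, ← Finset.sum_neg_distrib]
    refine Finset.sum_le_sum fun i _ => ?_
    rw [Finset.sum_mul, ← Finset.sum_neg_distrib]
    refine Finset.sum_le_sum fun j _ => ?_
    have hle : ∀ i, X i i ≤ X.trace := fun i =>
      Finset.single_le_sum (f := fun i => X i i) (fun j _ => hX.2 j j) (Finset.mem_univ i)
    have h1 : |C i j * X i j| ≤ |C i j| * X.trace := by
      rw [abs_mul, abs_of_nonneg (hX.2 i j)]
      refine mul_le_mul_of_nonneg_left ?_ (abs_nonneg _)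
      linarith [two_mul_le_of_posSemidef hX.1 i j, hle i, hle j]
    exact (abs_le.1 h1).1
  -- The summand `c` outweighs `C`; the extra 1 leaves room to subtract the identity.
  refine ⟨(c + 1) / η, ?_⟩
  set M := ((c + 1) / η) • A + C
  have hM : M.IsSymm := (hA.smul _).add hC
  have hcl : M - 1 ∈ closure (patternDual S) := by
    refine mem_closure_patternDual hS (hM.sub Matrix.isSymm_one) fun X hX => ?_
    rw [pairing_sub_left, pairing_add_left, pairing_smul_left, pairing_one_left]
    have h1 := mul_le_mul_of_nonneg_left (hηA X hX) (a := (c + 1) / η) (by positivity)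
    rw [← mul_assoc, div_mul_cancel₀ _ hη.ne'] at h1
    linarith [hc X hX.1]
  have hopen : IsOpen {N : Matrix κ κ ℝ | ∀ i j, |(M - 1) i j - N i j| < (Fintype.card κ : ℝ)⁻¹} := by
    simp only [Set.ofPred_forall]
    refine isOpen_iInter_of_finite fun i => isOpen_iInter_of_finite fun j => ?_
    exact isOpen_lt (by fun_prop) (by fun_prop)
  obtain ⟨N, hN, hNS⟩ := mem_closure_iff.1 hcl _ hopen (by
    intro i j
    have : Nonempty κ := ⟨i⟩
    simp [Fintype.card_pos])
  have hNs : N.IsSymm := by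
    obtain ⟨W, hW, -, P, Q, hP, hQ, -, hPQ⟩ := hNS
    rw [sub_eq_iff_eq_add.1 hPQ]
    exact ((posSemidef_iff_sum.1 hP).1.add hQ).add hW
  have hD := posSemidef_one_add_of_abs_le (D := M - 1 - N)
    ((hM.sub Matrix.isSymm_one).sub hNs) fun i j => (hN i j).le
  -- `N` is a point of the cone near `M - 1`, and the remainder is a small perturbation of the
  -- identity.
  have : M = N + (1 + (M - 1 - N)) := by abel
  rw [this]
  exact patternDual.add hNS (DNNDual_subset_patternDual S (DNNDual.of_posSemidef hD))

end ConicAlternative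

/-! ### The feasible values of `ϑ⁺` form a closed ray. -/

section Theta

variable {V : Type*}

/-- Adding `(t - s) I` raises the diagonal and preserves every other constraint. -/
theorem thetaPlusValues_mono {H : SimpleGraph V} {s t : ℝ} (hs : s ∈ thetaPlusValues H)
    (hst : s ≤ t) : t ∈ thetaPlusValues H := by
  classical
  obtain ⟨Z, hZ, hJ, hd, h0⟩ := hs
  have hI : ((t - s) • (1 : Matrix V V ℝ)).PosSemidef :=
    Matrix.PosSemidef.one.smul (sub_nonneg.2 hst)
  refine ⟨Z + (t - s) • 1, ⟨hZ.1.add hI, fun i j => add_nonneg (hZ.2 i j) ?_⟩, ?_,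
    fun u => by simp [hd], fun u v h => by simp [h0 u v h, h.ne]⟩
  · rw [Matrix.smul_apply, Matrix.one_apply]
    split_ifs <;> simp [hst]
  · rw [add_sub_right_comm]
    exact hJ.add hI

theorem one_le_of_mem_thetaPlusValues [Nonempty V] {H : SimpleGraph V} {t : ℝ}
    (ht : t ∈ thetaPlusValues H) : 1 ≤ t := by
  obtain ⟨Z, hZ, hJ, hd, h0⟩ := ht
  obtain ⟨u⟩ := ‹Nonempty V›
  have := hJ.diag_nonneg (i := u)
  simp [hd] at this
  exact this

variable [Fintype V]

theorem card_mem_thetaPlusValues (H : SimpleGraph V) :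
    (Fintype.card V : ℝ) ∈ thetaPlusValues H := by
  classical
  refine ⟨(Fintype.card V : ℝ) • 1, ⟨Matrix.PosSemidef.one.smul (by positivity), fun i j => ?_⟩,
    posSemidef_iff_sum.2 ⟨?_, fun x => ?_⟩, fun u => by simp, fun u v h => ?_⟩
  · rw [Matrix.smul_apply, Matrix.one_apply]
    split_ifs <;> simp
  · exact (Matrix.isSymm_one.smul _).sub (by ext; rfl)
  · have := sq_sum_le_card_mul_sum_sq (s := Finset.univ) (f := x)
    simp only [Matrix.sub_apply, Matrix.smul_apply, Matrix.one_apply, Matrix.of_apply, mul_sub,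
      sub_mul, Finset.sum_sub_distrib]
    simp only [mul_one, ← Finset.mul_sum, ← Finset.sum_mul]
    simp [mul_comm _ (Fintype.card V : ℝ), mul_assoc, ← Finset.mul_sum, ← pow_two]
    simpa using this
  · simp [h.ne]

/-- The minimum in the definition of `ϑ⁺` is attained. -/
theorem isLeast_thetaPlus [Nonempty V] (H : SimpleGraph V) :
    IsLeast (thetaPlusValues H) (thetaPlus H) := by
  obtain ⟨u₀⟩ := ‹Nonempty V›
  have := ‹Nonempty V›
  set n : ℝ := (Fintype.card V : ℝ)
  -- Since `n` is a feasible value, values above `n` may be discarded; the cut-off makes the set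
  -- compact. The value is read off as the entry at `u₀`.
  set K : Set (Matrix V V ℝ) := {Z | (Z ∈ DNN V ∧ ∀ u, Z u u ≤ n) ∧
    (Z - Matrix.of fun _ _ => (1 : ℝ)).PosSemidef ∧ (∀ u, Z u u = Z u₀ u₀) ∧
    ∀ u v, Hᶜ.Adj u v → Z u v = 0}
  have hK : IsCompact K := by
    suffices h : IsClosed {Z : Matrix V V ℝ | (Z - Matrix.of fun _ _ => (1 : ℝ)).PosSemidef ∧
        (∀ u, Z u u = Z u₀ u₀) ∧ ∀ u v, Hᶜ.Adj u v → Z u v = 0} from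
      (isCompact_DNN_of_diag_le (κ := V) n).inter_right h
    simp only [Set.ofPred_and, Set.ofPred_forall]
    refine (isClosed_posSemidef.preimage (f := fun Z : Matrix V V ℝ =>
      Z - Matrix.of fun _ _ => (1 : ℝ)) (by fun_prop)).inter
      ((isClosed_iInter fun u => ?_).inter
      (isClosed_iInter fun u => isClosed_iInter fun v => isClosed_iInter fun _ => ?_))
    · exact isClosed_eq (by fun_prop) (by fun_prop)
    · exact isClosed_eq (by fun_prop) (by fun_prop)
  have hmem : ∀ t ∈ thetaPlusValues H, t ≤ n → ∃ Z ∈ K, Z u₀ u₀ = t := by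
    rintro t ⟨Z, hZ, hJ, hd, h0⟩ ht
    exact ⟨Z, ⟨⟨hZ, fun u => (hd u).trans_le ht⟩, hJ, fun u => (hd u).trans (hd u₀).symm, h0⟩, hd u₀⟩
  obtain ⟨Z₁, hZ₁, -⟩ := hmem n (card_mem_thetaPlusValues H) le_rfl
  obtain ⟨Z, hZ, hmin⟩ := hK.exists_isMinOn (f := fun Z : Matrix V V ℝ => Z u₀ u₀) ⟨Z₁, hZ₁⟩
    (by fun_prop)
  have hleast : IsLeast (thetaPlusValues H) (Z u₀ u₀) := by
    refine ⟨⟨Z, hZ.1.1, hZ.2.1, hZ.2.2.1, hZ.2.2.2⟩, fun t ht => ?_⟩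
    rcases le_total t n with htn | htn
    · obtain ⟨Y, hY, rfl⟩ := hmem t ht htn
      exact hmin hY
    · exact (hZ.1.2 u₀).trans htn
  rw [thetaPlus, hleast.csInf_eq]
  exact hleast

theorem mem_thetaPlusValues_iff [Nonempty V] {H : SimpleGraph V} {t : ℝ} :
    t ∈ thetaPlusValues H ↔ thetaPlus H ≤ t :=
  ⟨fun h => (isLeast_thetaPlus H).2 h, thetaPlusValues_mono (isLeast_thetaPlus H).1⟩

end Theta

/-! ### A single block: its feasible matrices and the feasible points of `ϑ⁺`. -/

section Block

variable {V : Type*} [Fintype V]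

/-- The positions `(ui, vi)` with `u`, `v` adjacent and `(ui, uj)` with `i ≠ j`. -/
def zeroPattern (G : SimpleGraph V) (t : Level V) : BlockIdx V t → BlockIdx V t → Prop
  | some (u, i), some (v, j) => G.Adj u v ∧ i = j ∨ u = v ∧ i ≠ j
  | _, _ => False

theorem zeroPattern_symm (G : SimpleGraph V) (t : Level V) (a b : BlockIdx V t) :
    zeroPattern G t a b → zeroPattern G t b a := by
  rcases a with _ | ⟨u, i⟩ <;> rcases b with _ | ⟨v, j⟩ <;> simp only [zeroPattern, imp_self]
  rintro (⟨h, rfl⟩ | ⟨rfl, h⟩)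
  · exact Or.inl ⟨h.symm, rfl⟩
  · exact Or.inr ⟨rfl, h.symm⟩

/-- The feasible matrix of the block `t` built from a feasible point `Z` of value `t` for `ϑ⁺`. -/
def primalBlock (t : Level V) (Z : Matrix V V ℝ) : Matrix (BlockIdx V t) (BlockIdx V t) ℝ :=
  Matrix.of fun a b =>
    match a, b with
    | none, none => 1
    | none, some _ => 1 / ((t : ℕ) : ℝ)
    | some _, none => 1 / ((t : ℕ) : ℝ)
    | some (u, i), some (v, j) => 1 / ((t : ℕ) : ℝ) ^ 2 +
        1 / (((t : ℕ) : ℝ) * (((t : ℕ) : ℝ) - 1)) *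
          ((Z u v - 1) * ((if i = j then 1 else 0) - 1 / ((t : ℕ) : ℝ)))

theorem one_le_level (t : Level V) : (1 : ℝ) ≤ ((t : ℕ) : ℝ) := by
  exact_mod_cast (Finset.mem_Icc.1 t.2).1

-- The matrix is `w wᵀ` with `w = (1, 1/t, …, 1/t)`, plus `1 / (t (t - 1))` times the Kronecker
-- product of `Z - J` and `I - J/t`, extended by zero to the index 0. Both factors are positive
-- semidefinite, the second by Cauchy–Schwarz.
open scoped Kronecker in
theorem posSemidef_primalBlock (t : Level V) {Z : Matrix V V ℝ}
    (hZ : (Z - Matrix.of fun _ _ => (1 : ℝ)).PosSemidef) : (primalBlock t Z).PosSemidef := by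
  have ht := one_le_level t
  set s : ℝ := ((t : ℕ) : ℝ) with hs
  have hQ : ((1 : Matrix (Fin (t : ℕ)) (Fin (t : ℕ)) ℝ) -
      Matrix.of fun _ _ => 1 / s).PosSemidef := by
    refine posSemidef_iff_sum.2 ⟨Matrix.isSymm_one.sub (by ext; rfl), fun x => ?_⟩
    have := sq_sum_le_card_mul_sum_sq (s := Finset.univ) (f := x)
    simp only [Matrix.sub_apply, Matrix.one_apply, Matrix.of_apply, mul_sub,
      sub_mul, Finset.sum_sub_distrib]
    simp only [← Finset.mul_sum, ← Finset.sum_mul]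
    simp [← pow_two] at this ⊢
    rw [mul_right_comm, ← pow_two, ← div_eq_mul_inv, div_le_iff₀ (by positivity), mul_comm]
    exact this
  have hK := hZ.kronecker hQ
  -- For `s = 1` the coefficient is `1 / 0 = 0`, so the Kronecker term drops out.
  have hc : 0 ≤ 1 / (s * (s - 1)) :=
    div_nonneg zero_le_one (mul_nonneg (by linarith) (by linarith))
  refine posSemidef_iff_sum.2 ⟨?_, fun x => ?_⟩
  · have hZs : ∀ u v, Z u v = Z v u := fun u v => by
      have := (posSemidef_iff_sum.1 hZ).1.apply v u
      simpa using this
    ext a b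
    rcases a with _ | ⟨v, i⟩ <;> rcases b with _ | ⟨w, j⟩
    · rfl
    · rfl
    · rfl
    · simp [primalBlock, hZs w v, eq_comm]
  · have h1 := (posSemidef_iff_sum.1 hK).2 fun p => x (some p)
    have h2 : ∑ a, ∑ b, x a * primalBlock t Z a b * x b =
        (x none + 1 / s * ∑ p, x (some p)) ^ 2 + 1 / (s * (s - 1)) *
        ∑ p, ∑ q, x (some p) * ((Z - Matrix.of fun _ _ => (1 : ℝ)) ⊗ₖ
          ((1 : Matrix (Fin (t : ℕ)) (Fin (t : ℕ)) ℝ) - Matrix.of fun _ _ => 1 / s)) p q *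
          x (some q) := by
      have h3 : ∀ p q, x (some p) * primalBlock t Z (some p) (some q) * x (some q) =
          1 / s ^ 2 * (x (some p) * x (some q)) + 1 / (s * (s - 1)) * (x (some p) *
          ((Z - Matrix.of fun _ _ => (1 : ℝ)) ⊗ₖ
          ((1 : Matrix (Fin (t : ℕ)) (Fin (t : ℕ)) ℝ) - Matrix.of fun _ _ => 1 / s)) p q *
          x (some q)) := by
        intro p q
        simp only [primalBlock, Matrix.of_apply, Matrix.kroneckerMap_apply, Matrix.sub_apply,
          Matrix.one_apply, ← hs]
        ring
      simp only [Fintype.sum_option, h3, Finset.sum_add_distrib, ← Finset.mul_sum]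
      have h4 : ∀ p, primalBlock t Z none (some p) = 1 / s := fun p => rfl
      have h5 : ∀ p, primalBlock t Z (some p) none = 1 / s := fun p => rfl
      have h6 : primalBlock t Z none none = 1 := rfl
      simp only [h4, h5, h6, ← Finset.mul_sum, ← Finset.sum_mul]
      ring
    rw [h2]
    exact add_nonneg (sq_nonneg _) (mul_nonneg hc h1)

theorem primalBlock_mem_patternDNN {G : SimpleGraph V} {t : Level V} {Z : Matrix V V ℝ}
    (hZ : Z ∈ DNN V) (hJ : (Z - Matrix.of fun _ _ => (1 : ℝ)).PosSemidef)
    (hd : ∀ u, Z u u = ((t : ℕ) : ℝ)) (h0 : ∀ u v, G.Adj u v → Z u v = 0) :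
    primalBlock t Z ∈ patternDNN (zeroPattern G t) := by
  have ht := one_le_level t
  have hle : ∀ u v, Z u v ≤ ((t : ℕ) : ℝ) := fun u v => by
    linarith [two_mul_le_of_posSemidef hZ.1 u v, hd u, hd v]
  -- At level 1 the positive semidefinite matrix `Z - J` has zero trace, hence vanishes; this
  -- reconciles the default value of the coefficient with the formula `Z u v / s ^ 2` below.
  have hone : ((t : ℕ) : ℝ) = 1 → ∀ u v, Z u v = 1 := by
    intro h1 u v
    have h2 := (hJ.trace_eq_zero_iff).1 (by simp [Matrix.trace, hd, h1])
    have := congrFun (congrFun h2 u) v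
    simpa [sub_eq_zero] using this
  have hnei : ∀ i j : Fin (t : ℕ), i ≠ j → ((t : ℕ) : ℝ) - 1 ≠ 0 := by
    intro i j hij h
    have : (t : ℕ) = 1 := by exact_mod_cast sub_eq_zero.1 h
    exact hij (Fin.ext (by omega))
  set s : ℝ := ((t : ℕ) : ℝ) with hs
  have hs0 : s ≠ 0 := by positivity
  have hdiag : ∀ u v i, primalBlock t Z (some (u, i)) (some (v, i)) = Z u v / s ^ 2 := by
    intro u v i
    simp only [primalBlock, Matrix.of_apply, if_true, ← hs]
    by_cases h1 : s = 1
    · simp [h1, hone h1]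
    · have : s - 1 ≠ 0 := sub_ne_zero.2 h1
      field_simp
      ring
  -- Nonnegative because `Z u v ≤ t`, and zero at `u = v` because the diagonal of `Z` is `t`.
  have hoff : ∀ u v i j, i ≠ j → primalBlock t Z (some (u, i)) (some (v, j)) =
      (s - Z u v) / (s ^ 2 * (s - 1)) := by
    intro u v i j hij
    have := hnei i j hij
    simp only [primalBlock, Matrix.of_apply, if_neg hij, ← hs]
    field_simp
    ring
  refine ⟨⟨posSemidef_primalBlock t hJ, fun a b => ?_⟩, fun a b hab => ?_⟩
  · rcases a with _ | ⟨u, i⟩ <;> rcases b with _ | ⟨v, j⟩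
    · exact zero_le_one
    · exact one_div_nonneg.2 (zero_le_one.trans ht)
    · exact one_div_nonneg.2 (zero_le_one.trans ht)
    · by_cases hij : i = j
      · subst hij
        rw [hdiag]
        exact div_nonneg (hZ.2 u v) (by positivity)
      · rw [hoff u v i j hij]
        exact div_nonneg (by linarith [hle u v]) (mul_nonneg (by positivity) (by linarith))
  · rcases a with _ | ⟨u, i⟩ <;> rcases b with _ | ⟨v, j⟩ <;> simp only [zeroPattern] at hab
    rcases hab with ⟨h, rfl⟩ | ⟨rfl, h⟩
    · rw [hdiag, h0 u v h, zero_div]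
    · rw [hoff u u i j h, hd, sub_self, zero_div]

variable [DecidableEq V]

/-- The vector `e_0 - ∑ i, e_{ui}`. -/
def blockVec (t : Level V) (u : V) : BlockIdx V t → ℝ
  | none => 1
  | some (v, _) => if v = u then -1 else 0

theorem blockA_eq (t : Level V) (u : V) :
    blockA t u = Matrix.vecMulVec (blockVec t u) (blockVec t u) := by
  ext a b
  rcases a with _ | ⟨v, i⟩ <;> rcases b with _ | ⟨w, j⟩ <;>
    simp [blockA, blockVec, Matrix.vecMulVec_apply]
  split_ifs <;> simp_all

theorem posSemidef_sum_blockA (t : Level V) : (∑ u, blockA t u).PosSemidef := by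
  refine Matrix.posSemidef_sum _ fun u _ => ?_
  rw [blockA_eq]
  simpa using Matrix.posSemidef_vecMulVec_self_star (blockVec t u)

/-- If `⟨A_u, X⟩ = 0` for every `u`, then the vectors `e_0 - ∑ i, e_{ui}` lie in the kernel
of `X`. -/
theorem apply_none_eq_sum {t : Level V} {X : Matrix (BlockIdx V t) (BlockIdx V t) ℝ}
    (hX : X.PosSemidef) (hA : pairing (∑ u, blockA t u) X ≤ 0) (a : BlockIdx V t) (u : V) :
    X a none = ∑ i, X a (some (u, i)) := by
  have hnn : ∀ u, 0 ≤ pairing (blockA t u) X := fun u => by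
    rw [blockA_eq, pairing_vecMulVec]
    exact (posSemidef_iff_sum.1 hX).2 _
  rw [pairing_sum_left] at hA
  have h0 := (Finset.sum_eq_zero_iff_of_nonneg fun u _ => hnn u).1
    (hA.antisymm (Finset.sum_nonneg fun u _ => hnn u)) u (Finset.mem_univ u)
  rw [blockA_eq, pairing_vecMulVec] at h0
  have h1 : X *ᵥ blockVec t u = 0 := by
    refine (hX.dotProduct_mulVec_zero_iff _).1 ?_
    rw [← h0]
    simp only [dotProduct, Matrix.mulVec, Finset.mul_sum, mul_assoc, star_trivial]
  have h2 := congrFun h1 a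
  simp only [Matrix.mulVec, dotProduct, Fintype.sum_option, blockVec, Fintype.sum_prod_type,
    mul_ite, mul_neg, mul_one, mul_zero, Pi.zero_apply] at h2
  rw [Finset.sum_comm] at h2
  simp at h2
  linarith

/-- A nonzero feasible matrix in the block `t` gives a feasible point of value `t` for `ϑ⁺`. -/
theorem level_mem_thetaPlusValues {G : SimpleGraph V} {t : Level V}
    {X : Matrix (BlockIdx V t) (BlockIdx V t) ℝ} (hX : X ∈ patternDNN (zeroPattern G t))
    (hX0 : X ≠ 0) (hA : pairing (∑ u, blockA t u) X ≤ 0) :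
    ((t : ℕ) : ℝ) ∈ thetaPlusValues Gᶜ := by
  have hker := apply_none_eq_sum hX.1.1 hA
  have hsymm := (posSemidef_iff_sum.1 hX.1.1).1.apply
  have hdiag : ∀ u i, X (some (u, i)) (some (u, i)) = X none (some (u, i)) := by
    intro u i
    rw [hsymm (some (u, i)) none, hker _ u, Finset.sum_eq_single i]
    · intro j _ hj
      exact hX.2 (some (u, i)) (some (u, j)) (Or.inr ⟨rfl, hj.symm⟩)
    · simp
  -- If the corner vanished, so would its row by the kernel relation, then the diagonal by `hdiag`,
  -- and finally `X` through its trace.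
  have hc : 0 < X none none := by
    refine (hX.1.2 _ _).lt_of_ne fun h0 => hX0 (hX.1.1.trace_eq_zero_iff.1 ?_)
    rw [Matrix.trace, Fintype.sum_option]
    have : ∀ u i, X none (some (u, i)) = 0 := fun u i =>
      (Finset.sum_eq_zero_iff_of_nonneg fun i _ => hX.1.2 _ _).1 ((hker none u).symm.trans h0.symm)
        i (Finset.mem_univ i)
    simp [hdiag, this, ← h0]
  set c := X none none
  have hsum : ∀ u v, ∑ i, ∑ j, X (some (u, i)) (some (v, j)) = c := by
    intro u v
    simp only [← hker, hsymm none]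
    simp only [c, hker none u]
  -- Up to scaling, the sum of the diagonal subblocks `i = j`; the factor `t / c` makes its diagonal
  -- equal to `t`.
  set Z : Matrix V V ℝ := ∑ i, (((t : ℕ) : ℝ) / c) • X.submatrix (fun u => some (u, i))
    fun u => some (u, i)
  have hZ : ∀ u v, Z u v = ((t : ℕ) : ℝ) / c * ∑ i, X (some (u, i)) (some (v, i)) := by
    intro u v
    simp [Z, Matrix.sum_apply, Finset.mul_sum]
  refine ⟨Z, ⟨Matrix.posSemidef_sum _ fun i _ => (hX.1.1.submatrix _).smul (by positivity),
    fun u v => ?_⟩, ?_, fun u => ?_, fun u v huv => ?_⟩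
  · rw [hZ]
    exact mul_nonneg (by positivity) (Finset.sum_nonneg fun i _ => hX.1.2 _ _)
  -- Column `u` of `E i j` is `e_{ui} - e_{uj}`. Summing the compressions of `X` over all `i, j`
  -- gives `2t` times the diagonal subblocks minus twice the sum of all subblocks, whose entries are
  -- `c` by `hsum`; dividing by `2c` gives `Z - J`.
  · let E : Fin (t : ℕ) → Fin (t : ℕ) → Matrix (BlockIdx V t) V ℝ := fun i j => Matrix.of fun a u =>
      (if a = some (u, i) then 1 else 0) - if a = some (u, j) then 1 else 0
    have hE : ∀ i j u v, ((E i j)ᴴ * X * E i j) u v = X (some (u, i)) (some (v, i)) -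
        X (some (u, i)) (some (v, j)) - X (some (u, j)) (some (v, i)) +
        X (some (u, j)) (some (v, j)) := by
      intro i j u v
      simp [E, Matrix.mul_apply, sub_mul, mul_sub,
        Finset.sum_sub_distrib]
      ring
    have : Z - (Matrix.of fun _ _ => (1 : ℝ)) =
        ∑ i, ∑ j, (1 / (2 * c)) • ((E i j)ᴴ * X * E i j) := by
      ext u v
      simp only [Matrix.sub_apply, Matrix.of_apply, hZ, Matrix.sum_apply, Matrix.smul_apply, hE,
        smul_eq_mul, ← Finset.mul_sum, Finset.sum_add_distrib, Finset.sum_sub_distrib, hsum]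
      rw [Finset.sum_comm (f := fun i j => X (some (u, j)) (some (v, i))), hsum]
      simp only [Finset.sum_const, Finset.card_univ, Fintype.card_fin, nsmul_eq_mul,
        ← Finset.mul_sum]
      field_simp
      ring
    rw [this]
    exact Matrix.posSemidef_sum _ fun i _ => Matrix.posSemidef_sum _ fun j _ =>
      (hX.1.1.conjTranspose_mul_mul_same _).smul (by positivity)
  · simp only [hZ, hdiag, ← hker]
    exact div_mul_cancel₀ _ hc.ne'
  · rw [compl_compl] at huv
    rw [hZ, Finset.sum_eq_zero fun i _ =>
      hX.2 (some (u, i)) (some (v, i)) (Or.inl ⟨huv, rfl⟩), mul_zero]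

/-- Each row annihilates `blockVec t u`: the constants `1`, `1/t`, `1/t²` cancel over the `t`
indices, and the rows of `I - J/t` sum to zero. -/
theorem pairing_sum_blockA_primalBlock (t : Level V) (Z : Matrix V V ℝ) :
    pairing (∑ u, blockA t u) (primalBlock t Z) = 0 := by
  have ht := one_le_level t
  have ht0 : ((t : ℕ) : ℝ) ≠ 0 := by positivity
  rw [pairing_sum_left]
  refine Finset.sum_eq_zero fun u _ => ?_
  rw [blockA_eq, pairing_vecMulVec]
  refine Finset.sum_eq_zero fun a _ => ?_
  simp only [mul_assoc, ← Finset.mul_sum]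
  refine mul_eq_zero_of_right _ ?_
  rw [Fintype.sum_option, Fintype.sum_prod_type, Finset.sum_comm]
  rcases a with _ | ⟨v, i⟩
  · simp [primalBlock, blockVec, ht0]
  · simp [primalBlock, blockVec, Finset.sum_add_distrib, ← Finset.mul_sum,
      Finset.sum_sub_distrib, ht0]
    field_simp
    ring

end Block

/-! ### Direct sums of blocks. -/

section BlockDiagonal

variable {ι : Type*} {β : ι → Type*} [DecidableEq ι]

theorem isSymm_blockDiagonal' {M : ∀ i, Matrix (β i) (β i) ℝ} (hM : ∀ i, (M i).IsSymm) :
    (Matrix.blockDiagonal' M).IsSymm := by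
  rw [Matrix.IsSymm, Matrix.blockDiagonal'_transpose]
  exact congrArg _ (funext hM)

theorem blockDiagonal'_nonneg {M : ∀ i, Matrix (β i) (β i) ℝ} (hM : ∀ i a b, 0 ≤ M i a b)
    (p q : (i : ι) × β i) : 0 ≤ Matrix.blockDiagonal' M p q := by
  rw [Matrix.blockDiagonal'_apply]
  split_ifs
  · exact hM _ _ _
  · exact le_rfl

variable [Fintype ι] [∀ i, Fintype (β i)]

theorem pairing_blockDiagonal' (M : ∀ i, Matrix (β i) (β i) ℝ)
    (X : Matrix ((i : ι) × β i) ((i : ι) × β i) ℝ) :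
    pairing (Matrix.blockDiagonal' M) X = ∑ i, ∑ a, ∑ b, M i a b * X ⟨i, a⟩ ⟨i, b⟩ := by
  simp only [pairing, Fintype.sum_sigma]
  refine Finset.sum_congr rfl fun i _ => Finset.sum_congr rfl fun a _ => ?_
  rw [Finset.sum_eq_single i]
  · simp
  · intro j _ hj
    refine Finset.sum_eq_zero fun b _ => ?_
    rw [Matrix.blockDiagonal'_apply_ne _ _ _ hj.symm, zero_mul]
  · simp

theorem posSemidef_blockDiagonal' {M : ∀ i, Matrix (β i) (β i) ℝ} (hM : ∀ i, (M i).PosSemidef) :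
    (Matrix.blockDiagonal' M).PosSemidef := by
  choose B hB using fun i => exists_eq_conjTranspose_mul_self (hM i)
  obtain rfl : M = fun i => (B i)ᴴ * B i := funext hB
  rw [Matrix.blockDiagonal'_mul, ← Matrix.blockDiagonal'_conjTranspose]
  exact Matrix.posSemidef_conjTranspose_mul_self _

theorem blockDiagonal'_mem_DNN {M : ∀ i, Matrix (β i) (β i) ℝ} (hM : ∀ i, M i ∈ DNN (β i)) :
    Matrix.blockDiagonal' M ∈ DNN ((i : ι) × β i) :=
  ⟨posSemidef_blockDiagonal' fun i => (hM i).1, blockDiagonal'_nonneg fun i => (hM i).2⟩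

theorem blockDiagonal'_mem_DNNDual {M : ∀ i, Matrix (β i) (β i) ℝ}
    (hM : ∀ i, M i ∈ DNNDual (β i)) :
    Matrix.blockDiagonal' M ∈ DNNDual ((i : ι) × β i) := by
  choose P N hP hN hN0 hPN using hM
  refine ⟨_, _, posSemidef_blockDiagonal' hP, isSymm_blockDiagonal' hN,
    blockDiagonal'_nonneg hN0, ?_⟩
  rw [← Matrix.blockDiagonal'_add]
  exact congrArg _ (funext hPN)

theorem eq_of_pairing_eq {κ : Type*} [Fintype κ] {M N : Matrix κ κ ℝ} (hM : M.IsSymm)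
    (hN : N.IsSymm) (h : ∀ X : Matrix κ κ ℝ, X.IsSymm → pairing M X = pairing N X) : M = N := by
  have h1 : ∑ i, ∑ j, (M - N) i j * (M - N) i j = 0 := by
    have := h (M - N) (hM.sub hN)
    rw [← sub_eq_zero, ← pairing_sub_left] at this
    exact this
  ext i j
  have h2 := (Finset.sum_eq_zero_iff_of_nonneg fun i _ =>
    Finset.sum_nonneg fun j _ => mul_self_nonneg _).1 h1 i (Finset.mem_univ i)
  have h3 := (Finset.sum_eq_zero_iff_of_nonneg fun j _ => mul_self_nonneg _).1 h2 j
    (Finset.mem_univ j)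
  exact sub_eq_zero.1 (mul_self_eq_zero.1 h3)

end BlockDiagonal

/-! ### Dual feasible points and weak duality for the whole program. -/

section Program

variable {V : Type*} [Fintype V] [DecidableEq V]

theorem isSymm_sum {κ ι : Type*} [Fintype ι] {M : ι → Matrix κ κ ℝ} (hM : ∀ i, (M i).IsSymm) :
    (∑ i, M i).IsSymm := by
  rw [Matrix.IsSymm, Matrix.transpose_sum]
  exact Finset.sum_congr rfl fun i _ => hM i

theorem isSymm_elemSymm {κ : Type*} [DecidableEq κ] (a b : κ) : (elemSymm a b).IsSymm := by
  simp [elemSymm, Matrix.IsSymm, add_comm]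

/-- The terms of the program with coefficients from symmetric matrices supported on the zero
pattern sum up to the direct sum of these matrices. -/
theorem sum_extE_eq_blockDiagonal' (G : SimpleGraph V) [DecidableRel G.Adj]
    {W : ∀ t : Level V, Matrix (BlockIdx V t) (BlockIdx V t) ℝ} (hW : ∀ t, (W t).IsSymm)
    (hWS : ∀ t a b, ¬ zeroPattern G t a b → W t a b = 0) :
    (∑ t : Level V, ∑ i : Fin (t : ℕ), ∑ u : V, ∑ v : V,
        (if G.Adj u v then W t (some (u, i)) (some (v, i)) • extE t u i v i else 0)) +
      (∑ t : Level V, ∑ u : V, ∑ i : Fin (t : ℕ), ∑ j : Fin (t : ℕ),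
        (if i ≠ j then W t (some (u, i)) (some (u, j)) • extE t u i u j else 0)) =
      Matrix.blockDiagonal' W := by
  have hite : ∀ (p : Prop) [Decidable p] (c : ℝ) (a b : Idx V),
      (if p then c • elemSymm a b else 0).IsSymm := by
    intro p _ c a b
    split_ifs
    · exact (isSymm_elemSymm a b).smul c
    · exact Matrix.isSymm_zero
  -- Testing against symmetric `X` turns each `extE` into one entry of `X`, which avoids handling
  -- the halves in `elemSymm`.
  refine eq_of_pairing_eq (Matrix.IsSymm.add ?_ ?_) (isSymm_blockDiagonal' hW) fun X hX => ?_
  · exact isSymm_sum fun t => isSymm_sum fun i => isSymm_sum fun u => isSymm_sum fun v => hite _ _ _ _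
  · exact isSymm_sum fun t => isSymm_sum fun i => isSymm_sum fun u => isSymm_sum fun v => hite _ _ _ _
  have hpair : ∀ (p : Prop) [Decidable p] (c : ℝ) (a b : Idx V),
      pairing (if p then c • elemSymm a b else 0) X = if p then c * X a b else 0 := by
    intro p _ c a b
    split_ifs
    · rw [pairing_smul_left, pairing_elemSymm a b hX]
    · simp [pairing]
  rw [pairing_blockDiagonal', pairing_add_left]
  simp only [pairing_sum_left, extE, hpair]
  rw [← Finset.sum_add_distrib]
  refine Finset.sum_congr rfl fun t _ => ?_
  have h0 : ∀ b, W t none b = 0 := fun b => hWS t _ _ id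
  have h0' : ∀ a, W t a none = 0 := fun a => by rw [← (hW t).apply, h0]
  simp only [Fintype.sum_option, h0, h0', zero_mul, Finset.sum_const_zero, zero_add,
    Fintype.sum_prod_type]
  have hsplit : ∀ u v i j, W t (some (u, i)) (some (v, j)) * X ⟨t, some (u, i)⟩ ⟨t, some (v, j)⟩ =
      (if i = j then (if G.Adj u v then W t (some (u, i)) (some (v, j)) *
        X ⟨t, some (u, i)⟩ ⟨t, some (v, j)⟩ else 0) else 0) +
      (if u = v then (if i ≠ j then W t (some (u, i)) (some (v, j)) *
        X ⟨t, some (u, i)⟩ ⟨t, some (v, j)⟩ else 0) else 0) := by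
    intro u v i j
    have := hWS t (some (u, i)) (some (v, j))
    simp only [zeroPattern] at this
    by_cases hij : i = j <;> by_cases huv : u = v
    · subst hij huv
      simp at this ⊢
      simp [this]
    · subst hij
      by_cases hadj : G.Adj u v <;> simp_all
    · simp [hij, huv]
    · simp_all
  refine Eq.trans ?_ (Finset.sum_congr rfl fun u _ => Finset.sum_congr rfl fun i _ =>
    Finset.sum_congr rfl fun v _ => Finset.sum_congr rfl fun j _ => (hsplit u v i j).symm)
  simp only [Finset.sum_add_distrib]
  congr 1
  · rw [Finset.sum_comm]
    refine Finset.sum_congr rfl fun u _ => Finset.sum_congr rfl fun i _ =>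
      Finset.sum_congr rfl fun v _ => ?_
    simp
  · refine Finset.sum_congr rfl fun u _ => Finset.sum_congr rfl fun i _ => ?_
    rw [Finset.sum_eq_single u]
    · simp
    · intro v _ hv
      simp [hv.symm]
    · simp

/-- In each block some multiple of `∑ u, A_u` makes the objective matrix dually feasible. -/
theorem exists_smul_sum_blockA_add_mem (G : SimpleGraph V) (k : ℝ)
    (hk : ∀ t : Level V, ((t : ℕ) : ℝ) ∈ thetaPlusValues Gᶜ → k ≤ ((t : ℕ) : ℝ)) (t : Level V) :
    ∃ m : ℝ, m • ∑ u, blockA t u + (((t : ℕ) : ℝ) - k) • elemSymm (none : BlockIdx V t) none ∈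
      patternDual (zeroPattern G t) := by
  by_cases ht : ((t : ℕ) : ℝ) ∈ thetaPlusValues Gᶜ
  · refine ⟨0, ?_⟩
    rw [zero_smul, zero_add]
    refine DNNDual_subset_patternDual _ (DNNDual.of_nonneg ((isSymm_elemSymm _ _).smul _)
      fun a b => mul_nonneg (sub_nonneg.2 (hk t ht)) ?_)
    simp only [elemSymm, Matrix.smul_apply, Matrix.add_apply, Matrix.single_apply, smul_eq_mul]
    positivity
  · refine exists_smul_add_mem_patternDual (zeroPattern_symm G t)
      (posSemidef_iff_sum.1 (posSemidef_sum_blockA t)).1 ((isSymm_elemSymm _ _).smul _)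
      fun X hX hX0 => ?_
    by_contra! hA
    exact ht (level_mem_thetaPlusValues hX hX0 hA)

/-- The multiplier `mu` is shared by all blocks. Since `∑ u, A_u` is positive semidefinite, the
block multipliers can all be raised to a common bound. -/
theorem exists_dualMatrix_mem_DNNDual (G : SimpleGraph V) [DecidableRel G.Adj] (k : ℝ)
    (hk : ∀ t : Level V, ((t : ℕ) : ℝ) ∈ thetaPlusValues Gᶜ → k ≤ ((t : ℕ) : ℝ)) :
    ∃ mu y z, dualMatrix G k mu y z ∈ DNNDual (Idx V) := by
  choose m hm using exists_smul_sum_blockA_add_mem G k hk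
  obtain ⟨c, hc⟩ : ∃ c : ℝ, ∀ t, m t ≤ c := by
    obtain ⟨c, hc⟩ := (Set.finite_range m).bddAbove
    exact ⟨c, fun t => hc ⟨t, rfl⟩⟩
  have hmem : ∀ t : Level V, c • ∑ u, blockA t u +
      (((t : ℕ) : ℝ) - k) • elemSymm (none : BlockIdx V t) none ∈
      patternDual (zeroPattern G t) := by
    intro t
    have h := patternDual.add (hm t) (DNNDual_subset_patternDual (zeroPattern G t)
      (DNNDual.of_posSemidef ((posSemidef_sum_blockA t).smul (sub_nonneg.2 (hc t)))))
    convert h using 1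
    rw [sub_smul c]
    abel
  choose W hW hWS hD using hmem
  refine ⟨-c, fun t u v i => W t (some (u, i)) (some (v, i)),
    fun t u i j => W t (some (u, i)) (some (u, j)), ?_⟩
  have h := blockDiagonal'_mem_DNNDual hD
  convert h using 1
  rw [dualMatrix, sub_sub _ (Finset.sum _ _), sum_extE_eq_blockDiagonal' G hW hWS, matA, matB, matC,
    ← Matrix.blockDiagonal'_smul, ← Matrix.blockDiagonal'_smul, ← Matrix.blockDiagonal'_sub,
    ← Matrix.blockDiagonal'_sub, ← Matrix.blockDiagonal'_sub]
  congr 1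
  funext t
  simp only [Pi.sub_apply, Pi.smul_apply]
  module

/-- Weak duality: if `t` is a feasible value for `ϑ⁺`, then no feasible `λ` for `ε = 0`
exceeds `t`. -/
theorem le_level_of_dualMatrix_mem_Knc (G : SimpleGraph V) [DecidableRel G.Adj] {t : Level V}
    (ht : ((t : ℕ) : ℝ) ∈ thetaPlusValues Gᶜ) {lam mu : ℝ}
    {y : (t : Level V) → V → V → Fin (t : ℕ) → ℝ}
    {z : (t : Level V) → V → Fin (t : ℕ) → Fin (t : ℕ) → ℝ}
    (h : dualMatrix G lam mu y z ∈ Knc (Idx V) 0) : lam ≤ ((t : ℕ) : ℝ) := by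
  obtain ⟨Z, hZ, hJ, hd, h0⟩ := ht
  rw [compl_compl] at h0
  -- The test matrix lives in block `t` alone, where its corner is 1: it pairs to `t` with `C`, to 1
  -- with `B`, and to 0 with `A` and the free terms.
  set Y : ∀ s : Level V, Matrix (BlockIdx V s) (BlockIdx V s) ℝ :=
    fun s => if s = t then primalBlock s Z else 0
  have hY : ∀ s, Y s ∈ patternDNN (zeroPattern G s) := by
    intro s
    by_cases hs : s = t
    · subst hs
      simpa [Y] using primalBlock_mem_patternDNN hZ hJ hd h0
    · simpa [Y, hs] using ⟨⟨.zero, fun _ _ => le_rfl⟩, fun _ _ _ => rfl⟩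
  set X := Matrix.blockDiagonal' Y
  have hX : X ∈ DNN (Idx V) := blockDiagonal'_mem_DNN fun s => (hY s).1
  have hXs : X.IsSymm := (posSemidef_iff_sum.1 hX.1).1
  have hpair : ∀ M : ∀ s : Level V, Matrix (BlockIdx V s) (BlockIdx V s) ℝ,
      pairing (Matrix.blockDiagonal' M) X = pairing (M t) (primalBlock t Z) := by
    intro M
    rw [pairing_blockDiagonal', Finset.sum_eq_single t]
    · simp [X, Y, pairing]
    · intro s _ hs
      simp [X, Y, hs]
    · simp
  have hps : (primalBlock t Z).IsSymm := (posSemidef_iff_sum.1 (posSemidef_primalBlock t hJ)).1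
  have h1 : primalBlock t Z none none = 1 := rfl
  have hE : ∀ (p : Prop) [Decidable p] (c : ℝ) (s : Level V) (a b : BlockIdx V s),
      (p → zeroPattern G s a b) →
      pairing (if p then c • elemSymm (⟨s, a⟩ : Idx V) ⟨s, b⟩ else 0) X = 0 := by
    intro p _ c s a b hp
    split_ifs with hp'
    · rw [pairing_smul_left, pairing_elemSymm _ _ hXs]
      simp [X, (hY s).2 a b (hp hp')]
    · simp [pairing]
  have hy : pairing (∑ t : Level V, ∑ i : Fin (t : ℕ), ∑ u : V, ∑ v : V,
      (if G.Adj u v then y t u v i • extE t u i v i else 0)) X = 0 := by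
    simp only [pairing_sum_left]
    exact Finset.sum_eq_zero fun s _ => Finset.sum_eq_zero fun i _ => Finset.sum_eq_zero fun u _ =>
      Finset.sum_eq_zero fun v _ => hE _ _ _ _ _ fun h => Or.inl ⟨h, rfl⟩
  have hz : pairing (∑ t : Level V, ∑ u : V, ∑ i : Fin (t : ℕ), ∑ j : Fin (t : ℕ),
      (if i ≠ j then z t u i j • extE t u i u j else 0)) X = 0 := by
    simp only [pairing_sum_left]
    exact Finset.sum_eq_zero fun s _ => Finset.sum_eq_zero fun u _ => Finset.sum_eq_zero fun i _ =>
      Finset.sum_eq_zero fun j _ => hE _ _ _ _ _ fun h => Or.inr ⟨rfl, h⟩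
  have hnn : 0 ≤ pairing (dualMatrix G lam mu y z) X := sum_mul_nonneg_of_mem_Knc h hX
  rw [dualMatrix, pairing_sub_left, pairing_sub_left, pairing_sub_left, pairing_sub_left, hy, hz,
    pairing_smul_left, pairing_smul_left, matA, matB, matC, hpair, hpair, hpair,
    pairing_sum_blockA_primalBlock, pairing_smul_left, pairing_elemSymm _ _ hps, h1] at hnn
  linarith

end Program

end QuantumTheta

end

theorem lemma4p14 {V : Type*} [Fintype V] [DecidableEq V] [Nonempty V]
    (G : SimpleGraph V) [DecidableRel G.Adj] (ε : ℝ) (hε : 0 ≤ ε) :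
    (((⌈QuantumTheta.thetaPlus Gᶜ⌉ : ℤ) : ℝ) : EReal) ≤ QuantumTheta.Psi ε G ∧
      (ε = 0 → (((⌈QuantumTheta.thetaPlus Gᶜ⌉ : ℤ) : ℝ) : EReal) = QuantumTheta.Psi ε G) := by
  have hle : ∀ ε : ℝ, 0 ≤ ε →
      (((⌈QuantumTheta.thetaPlus Gᶜ⌉ : ℤ) : ℝ) : EReal) ≤ QuantumTheta.Psi ε G := by
    intro ε hε
    obtain ⟨mu, y, z, h⟩ := QuantumTheta.exists_dualMatrix_mem_DNNDual G
      ((⌈QuantumTheta.thetaPlus Gᶜ⌉ : ℤ) : ℝ) fun t ht => by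
        have h1 := QuantumTheta.mem_thetaPlusValues_iff.1 ht
        -- Levels are integers, so a feasible level lies above the ceiling; hence the rounding.
        have h2 : ⌈QuantumTheta.thetaPlus Gᶜ⌉ ≤ ((t : ℕ) : ℤ) := Int.ceil_le.2 (by exact_mod_cast h1)
        exact_mod_cast h2
    exact le_sSup ⟨_, mu, y, z, QuantumTheta.DNNDual_subset_Knc hε h, rfl⟩
  refine ⟨hle ε hε, ?_⟩
  rintro rfl
  refine (hle 0 le_rfl).antisymm (sSup_le ?_)
  rintro _ ⟨lam, mu, y, z, h, rfl⟩
  have h1 := QuantumTheta.one_le_of_mem_thetaPlusValues (QuantumTheta.isLeast_thetaPlus Gᶜ).1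
  have hn := (QuantumTheta.isLeast_thetaPlus Gᶜ).2 (QuantumTheta.card_mem_thetaPlusValues Gᶜ)
  have hk1 : (1 : ℤ) ≤ ⌈QuantumTheta.thetaPlus Gᶜ⌉ := by
    exact_mod_cast h1.trans (Int.le_ceil _)
  have hkn : ⌈QuantumTheta.thetaPlus Gᶜ⌉ ≤ (Fintype.card V : ℤ) :=
    Int.ceil_le.2 (by exact_mod_cast hn)
  obtain ⟨k, hk⟩ := Int.eq_ofNat_of_zero_le (zero_le_one.trans hk1)
  have hkc : ((⌈QuantumTheta.thetaPlus Gᶜ⌉ : ℤ) : ℝ) = (k : ℝ) := by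
    rw [hk]
    simp
  rw [hk] at hk1 hkn
  -- The bounds `1 ≤ ϑ⁺ ≤ n` make the ceiling an actual level of the program.
  have hmem : k ∈ Finset.Icc 1 (Fintype.card V) :=
    Finset.mem_Icc.2 ⟨by exact_mod_cast hk1, by exact_mod_cast hkn⟩
  have ht : (k : ℝ) ∈ QuantumTheta.thetaPlusValues Gᶜ :=
    QuantumTheta.mem_thetaPlusValues_iff.2 (hkc ▸ Int.le_ceil _)
  rw [hkc]
  exact EReal.coe_le_coe_iff.2
    (QuantumTheta.le_level_of_dualMatrix_mem_Knc G (t := ⟨k, hmem⟩) ht h)
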